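/- Let $\boldsymbol a=(a_1,\dots,a_N)$ be a sequence of positive integers with $\gcd(\boldsymbol a)=1$. For a positive integer $f$ put $d=n(f\mid\boldsymbol a)=\#\{i: f\mid a_i\}$, and for an integer $t\ge 0$ let $$W_f(t;\boldsymbol a)=-\operatorname{Res}_{s=0}\sum_{\zeta}\frac{\zeta^{-t}e^{-ts}}{\prod_{i=1}^N(1-\zeta^{a_i}e^{a_is})},$$ where $\zeta$ runs over the primitive $f$-th roots of unity in $\mathbb C$ (the Sylvester wave). Algorithm Float-Denum treats each divisor $f$ of an entry of $\boldsymbol a$ as follows. Let $\eta$ be a number that stands for $e^{2\pi\sqrt{-1}/f}$, $J_f=\{j:1\le j\le f,\ \gcd(j,f)=1\}$, $g(s)=s/(e^s-1)$, $g(s,y)=1/(1-y(e^s-1))$. Tabulate $\eta^c$ ($0\le c<f$) and $\frac1{1-\eta^c}$, $\frac{\eta^c}{1-\eta^c}$ ($1\le c<f$). For every $j\in J_f$ compute the coefficients $A_0(f,j),\dots,A_{d-1}(f,j)$ in $$\prod_{i:f\mid a_i}g(a_is)\prod_{i:f\nmid a_i}g\Big(a_is,\frac{\eta^{ja_i}}{1-\eta^{ja_i}}\Big)\equiv\sum_{k=0}^{d-1}A_k(f,j)s^k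 \pmod{s^d}$$ by the log-exponential trick: compute the truncated logarithms of $g(s)$ and of each $g(s,y)$, form the sums of their rescalings $s\mapsto a_is$ over each residue class modulo $f$ through the power sums of the $a_i$ (obtained from products of linear factors computed by divide and conquer), add up, and exponentiate; products of truncated series are computed by the fast Fourier transform, inverses and exponentials by Newton iteration. Then return the coefficients of the polynomials $$P_i(t)=\frac1{\prod_{i':f\mid a_{i'}}a_{i'}}\sum_{m=0}^{d-1}\frac{(-1)^{d+m+1}}{m!}t^m\sum_{j\in J_f}\frac{\eta^{-ij}A_{d-1-m}(f,j)}{\prod_{i':f\nmid a_{i'}}(1-\eta^{ja_{i'}})}\qquad(1\le i\le f).$$ **Theorem.** (1) There is an absolute constant $C$ such that for all $\boldsymbol a$ as above and every $f$ that divides some $a_i$, the part of Algorithm Float-Denum for $f$ uses at most $$C\,\big(f\,d\log(d+1)+N\log^2(d+1)\big)\,\varphi(f)$$ operations in $\mathbb C$ (additions, subtractions, multiplications, divisions, and the loading of an integer or of a root of unity $e^{2\pi\sqrt{-1}/n}$, each counted as one), whatever numerical values stand for the roots of unity and for the results of operations. It computes $W_f(t;\boldsymbol a)$ correctly: there are polynomials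 $P_1,\dots,P_f\in\mathbb C[t]$ of degree less than $d$ with $W_f(t;\boldsymbol a)=P_i(t)$ whenever $t\equiv i\pmod f$; in exact arithmetic with exact roots of unity the algorithm returns exactly their coefficients; and for every $\varepsilon>0$ there is $u>0$ (depending on $\boldsymbol a$, $f$ and $\varepsilon$) such that, whenever the numbers that stand for the integers and for the roots of unity and the results of all operations have relative error at most $u$ (nothing being assumed about quotients by $0$), every coefficient returned differs from the correct one by less than $\varepsilon$. (2) For every $M$ there is a polynomial $p$ such that for all $N$ and all $\boldsymbol a=(a_1,\dots,a_N)$ as above with $a_i\le M$ for all $i$, Algorithm Float-Denum uses at most $p(N)$ operations in $\mathbb C$ in total, over all divisors $f$ of entries of $\boldsymbol a$. -/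

import Mathlib

open Polynomial

namespace FloatDenum

/-! ### Sylvester waves -/

/-- The Laurent series in `s` of the function `e ^ (c s)`. -/
noncomputable def expSeries (c : ℂ) : LaurentSeries ℂ :=
  ((PowerSeries.rescale c (PowerSeries.exp ℂ) : PowerSeries ℂ) : LaurentSeries ℂ)

/-- The Sylvester wave
`W_f(t; a) = - Res_{s=0} ∑_ζ ζ^(-t) e^(-ts) / ∏_i (1 - ζ^(a_i) e^(a_i s))`,
where `ζ` ranges over the primitive `f`-th roots of unity in `ℂ`; the residue is the coefficient of
`s^(-1)` in the Laurent expansion. -/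
noncomputable def sylvesterWave (f : ℕ) (a : List ℕ) (t : ℕ) : ℂ :=
  - (∑ ζ ∈ primitiveRoots f ℂ,
      HahnSeries.C (ζ⁻¹ ^ t) * expSeries (-(t : ℂ)) /
        (a.map fun x => 1 - HahnSeries.C (ζ ^ x) * expSeries (x : ℂ)).prod).coeff (-1)

/-- `n(f ∣ a)`: the number of entries of `a` that are divisible by `f`. -/
def numDiv (f : ℕ) (a : List ℕ) : ℕ := a.countP (fun x => f ∣ x)

/-- `F = [P 1, …, P f]` is a quasi-polynomial of period `f`: `F t = P i (t)` whenever
`t ≡ i (mod f)`, `1 ≤ i ≤ f`. -/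
def IsQuasiPoly (f : ℕ) (F : ℕ → ℂ) (P : ℕ → ℂ[X]) : Prop :=
  ∀ t i : ℕ, 1 ≤ i → i ≤ f → t ≡ i [MOD f] → F t = (P i).eval (t : ℂ)

/-- The table whose `i`-th row (`1 ≤ i ≤ f`) lists the coefficients of `t^0, …, t^(d-1)` in
`P i`. -/
noncomputable def coeffTable (f d : ℕ) (P : ℕ → ℂ[X]) : List (List ℂ) :=
  (List.range f).map fun i => (List.range d).map fun m => (P (i + 1)).coeff m

/-! ### Computations with a count of the arithmetic operations -/

/-- A result together with the number of arithmetic operations spent on it. -/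
structure Counted (α : Type) where
  val : α
  ops : ℕ

instance : Monad Counted where
  pure x := ⟨x, 0⟩
  bind x g := ⟨(g x.val).val, x.ops + (g x.val).ops⟩

/-- An arithmetic (exact or rounded) on a set `K` of numbers. `nat n` is the number that stands for
the integer `n`, and `root n` is the number that stands for `e^(2πi/n)`. The algorithms below are
written for an arbitrary `K`, so they have no access to numbers except through these operations. -/
structure Arith (K : Type) where
  nat : ℕ → K
  root : ℕ → K
  plus : K → K → K
  minus : K → K → K
  times : K → K → K
  quot : K → K → K

namespace Arith

/-- Exact arithmetic in `ℂ`. -/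
noncomputable def exact : Arith ℂ where
  nat n := n
  root n := Complex.exp (2 * Real.pi * Complex.I / n)
  plus x y := x + y
  minus x y := x - y
  times x y := x * y
  quot x y := x / y

/-- The standard model of floating arithmetic with unit roundoff `u`: the values that stand for
integers, for the roots of unity and for the results of operations have relative error at most
`u`. Nothing is assumed on a quotient by zero. -/
structure HasRoundoff (A : Arith ℂ) (u : ℝ) : Prop where
  nat (n : ℕ) : ‖A.nat n - (n : ℂ)‖ ≤ u * ‖(n : ℂ)‖
  root (n : ℕ) (hn : 0 < n) :
    ‖A.root n - Complex.exp (2 * Real.pi * Complex.I / n)‖ ≤ u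
  plus (x y : ℂ) : ‖A.plus x y - (x + y)‖ ≤ u * ‖x + y‖
  minus (x y : ℂ) : ‖A.minus x y - (x - y)‖ ≤ u * ‖x - y‖
  times (x y : ℂ) : ‖A.times x y - x * y‖ ≤ u * ‖x * y‖
  quot (x y : ℂ) (hy : y ≠ 0) : ‖A.quot x y - x / y‖ ≤ u * ‖x / y‖

/-! Each use of the arithmetic costs one operation, including the loading of an integer or of a
root of unity. Operations on indices and the rearrangement of lists are not counted. -/

def natC {K : Type} (A : Arith K) (n : ℕ) : Counted K := ⟨A.nat n, 1⟩
def rootC {K : Type} (A : Arith K) (n : ℕ) : Counted K := ⟨A.root n, 1⟩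
def plusC {K : Type} (A : Arith K) (x y : K) : Counted K := ⟨A.plus x y, 1⟩
def minusC {K : Type} (A : Arith K) (x y : K) : Counted K := ⟨A.minus x y, 1⟩
def timesC {K : Type} (A : Arith K) (x y : K) : Counted K := ⟨A.times x y, 1⟩
def quotC {K : Type} (A : Arith K) (x y : K) : Counted K := ⟨A.quot x y, 1⟩

end Arith

/-! ### Lists -/

def mapC {α β : Type} (g : α → Counted β) : List α → Counted (List β)
  | [] => pure []
  | x :: xs => do
    let y ← g x
    let ys ← mapC g xs
    pure (y :: ys)

def zipC {α β γ : Type} (g : α → β → Counted γ) : List α → List β → Counted (List γ)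
  | x :: xs, y :: ys => do
    let w ← g x y
    let ws ← zipC g xs ys
    pure (w :: ws)
  | _, _ => pure []

def foldC {α β : Type} (g : β → α → Counted β) : β → List α → Counted β
  | s, [] => pure s
  | s, x :: xs => do
    let s' ← g s x
    foldC g s' xs

/-- Truncate the list `l` or extend it by copies of `z` to the length `n`. -/
def pad {K : Type} (n : ℕ) (z : K) (l : List K) : List K :=
  l.take n ++ List.replicate (n - l.length) z

/-- The entries of a list at the even positions `0, 2, 4, …`. -/
def evens {K : Type} : List K → List K
  | [] => []
  | [x] => [x]
  | x :: _ :: l => x :: evens l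

/-! ### Fast arithmetic of truncated power series

A list `[c_0, …, c_(n-1)]` stands for `∑ c_k s^k` modulo `s^n`. -/

/-- `[x, x w, …, x w^(n-1)]`. -/
def geom {K : Type} (A : Arith K) (w : K) : ℕ → K → Counted (List K)
  | 0, _ => pure []
  | n + 1, x => do
    let y ← A.timesC x w
    let l ← geom A w n y
    pure (x :: l)

/-- Fast Fourier transform of a list of length `2^k`, with respect to a primitive `2^k`-th root of
unity `w`: the values at `w^0, w^1, …` of the polynomial with the given coefficients. -/
def fft {K : Type} (A : Arith K) : ℕ → K → List K → Counted (List K)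
  | 0, _, l => pure l
  | k + 1, w, l => do
    let w2 ← A.timesC w w
    let e ← fft A k w2 (evens l)
    let o ← fft A k w2 (evens l.tail)
    let one ← A.natC 1
    let ws ← geom A w (2 ^ k) one
    let t ← zipC A.timesC ws o
    let u ← zipC A.plusC e t
    let v ← zipC A.minusC e t
    pure (u ++ v)

/-- The first `n` coefficients of the product of two polynomials. -/
def seriesMul {K : Type} (A : Arith K) (n : ℕ) (p q : List K) : Counted (List K) := do
  let z ← A.natC 0
  let one ← A.natC 1
  let k := Nat.clog 2 (p.length + q.length)
  let w ← A.rootC (2 ^ k)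
  let wi ← A.quotC one w
  let size ← A.natC (2 ^ k)
  let p' ← fft A k w (pad (2 ^ k) z p)
  let q' ← fft A k w (pad (2 ^ k) z q)
  let r' ← zipC A.timesC p' q'
  let r ← fft A k wi r'
  let r ← mapC (fun x => A.quotC x size) r
  pure (pad n z r)

/-- `1 / p` modulo `s^(2^k)` for `p(0) = 1`, by Newton iteration `g ↦ g (2 - p g)`. -/
def seriesInv {K : Type} (A : Arith K) (p : List K) : ℕ → Counted (List K)
  | 0 => do
    let one ← A.natC 1
    pure [one]
  | k + 1 => do
    let g ← seriesInv A p k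
    let z ← A.natC 0
    let two ← A.natC 2
    let n := 2 ^ (k + 1)
    let pg ← seriesMul A n (pad n z p) g
    let c ← zipC A.minusC (pad n z [two]) pg
    seriesMul A n g c

/-- `ln p` modulo `s^n` for `p(0) = 1`, as the integral of `p' / p`. -/
def seriesLog {K : Type} (A : Arith K) (n : ℕ) (p : List K) : Counted (List K) := do
  let z ← A.natC 0
  let p := pad n z p
  let dp ← zipC (fun i c => do
    let m ← A.natC (i + 1)
    A.timesC m c) (List.range (n - 1)) p.tail
  let g ← seriesInv A p (Nat.clog 2 n)
  let q ← seriesMul A (n - 1) dp (pad n z g)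
  let r ← zipC (fun i c => do
    let m ← A.natC (i + 1)
    A.quotC c m) (List.range (n - 1)) q
  pure (pad n z (z :: r))

/-- `e^h` modulo `s^(2^k)` for `h(0) = 0`, by Newton iteration `e ↦ e (1 + h - ln e)`. -/
def seriesExp {K : Type} (A : Arith K) (h : List K) : ℕ → Counted (List K)
  | 0 => do
    let one ← A.natC 1
    pure [one]
  | k + 1 => do
    let e ← seriesExp A h k
    let z ← A.natC 0
    let one ← A.natC 1
    let n := 2 ^ (k + 1)
    let l ← seriesLog A n e
    let x ← zipC A.minusC (pad n z h) l
    let c ← zipC A.plusC (pad n z [one]) x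
    seriesMul A n e c

/-! ### Generalized Todd polynomials by the log-exponential trick -/

/-- `∏ (1 - b s)` over a list of at most `2^k` numbers `b`, by divide and conquer. -/
def linearProd {K : Type} (A : Arith K) : ℕ → List K → Counted (List K)
  | 0, [] => do
    let one ← A.natC 1
    pure [one]
  | 0, b :: _ => do
    let z ← A.natC 0
    let one ← A.natC 1
    let b' ← A.minusC z b
    pure [one, b']
  | k + 1, l => do
    let p ← linearProd A k (l.take (2 ^ k))
    let q ← linearProd A k (l.drop (2 ^ k))
    seriesMul A (p.length + q.length - 1) p q

/-- Cut a list into blocks of length `d` (the last one may be shorter). -/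
def blocks {K : Type} (d : ℕ) (l : List K) : List (List K) :=
  (List.range ((l.length + d - 1) / d)).map fun r => (l.drop (r * d)).take d

/-- `∑_{b ∈ B} H(b s)` modulo `s^d`, for `H(0) = 0`. The power sums `∑ b^k` are read off from
`- ∑_{b ∈ B} ln (1 - b s) = ∑_k (∑ b^k) s^k / k`, block by block. -/
def addSimilar {K : Type} (A : Arith K) (d : ℕ) (H B : List K) : Counted (List K) := do
  let z ← A.natC 0
  let c ← foldC (fun acc b => do
    let p ← linearProd A (Nat.clog 2 b.length) b
    let l ← seriesLog A d p
    zipC A.minusC acc l) (List.replicate d z) (blocks d B)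
  let s ← zipC (fun k x => do
    let m ← A.natC k
    A.timesC m x) (List.range d) c
  zipC A.timesC s H

/-- `[x, x (i+1), x (i+1) (i+2), …]` with `n` entries; `[0!, …, (n-1)!]` for `i = 0`, `x = 1`. -/
def factorials {K : Type} (A : Arith K) : ℕ → ℕ → K → Counted (List K)
  | 0, _, _ => pure []
  | n + 1, i, x => do
    let m ← A.natC (i + 1)
    let y ← A.timesC x m
    let l ← factorials A n (i + 1) y
    pure (x :: l)

/-- `ln g(s)` modulo `s^d`, where `g(s) = s / (e^s - 1)`. -/
def lnTodd {K : Type} (A : Arith K) (d : ℕ) : Counted (List K) := do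
  let z ← A.natC 0
  let one ← A.natC 1
  let fact ← factorials A (d + 1) 0 one
  let p ← mapC (fun x => A.quotC one x) fact.tail
  let l ← seriesLog A d p
  mapC (fun x => A.minusC z x) l

/-- `ln g(s, y)` modulo `s^d`, where `g(s, y) = 1 / (1 - y (e^s - 1))`. -/
def lnToddY {K : Type} (A : Arith K) (d : ℕ) (y : K) : Counted (List K) := do
  let z ← A.natC 0
  let one ← A.natC 1
  let fact ← factorials A d 0 one
  let p ← mapC (fun x => do
    let c ← A.quotC y x
    A.minusC z c) fact.tail
  let l ← seriesLog A d (one :: p)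
  mapC (fun x => A.minusC z x) l

/-- The first `d` coefficients of
`∏_{b ∈ B₀} g(b s) * ∏_{(y, B) ∈ Bs} ∏_{b ∈ B} g(b s, y)`. -/
def gtd {K : Type} (A : Arith K) (d : ℕ) (B₀ : List K) (Bs : List (K × List K)) :
    Counted (List K) := do
  let z ← A.natC 0
  let h₀ ← lnTodd A d
  let H₀ ← addSimilar A d h₀ B₀
  let H ← foldC (fun acc yB => do
    let h ← lnToddY A d yB.1
    let S ← addSimilar A d h yB.2
    zipC A.plusC acc S) H₀ Bs
  let F ← seriesExp A H (Nat.clog 2 d)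
  pure (pad d z F)

/-! ### The algorithm -/

/-- `J_f = {j : 1 ≤ j ≤ f, gcd(j, f) = 1}`. -/
def unitResidues (f : ℕ) : List ℕ := (List.range' 1 f).filter fun j => Nat.gcd j f = 1

/-- The round of the algorithm for one `j ∈ J_f`. Given are the table `pw` of the powers
`η^0, …, η^(f-1)` of the root of unity `η`, the table `rec` of the numbers `1 / (1 - η^c)`,
the table `ys` of the numbers `η^c / (1 - η^c)` (`1 ≤ c ≤ f - 1`, the entries of index `0` are not
used), the list `B₀` of the `a_i` that are divisible by `f`, and the list `Bs` of the lists of all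
`a_i ≡ c (mod f)`, for `c = 1, …, f - 1`. The result has `f` rows; entry `m` of row `i` is
`η^(-ij) A_(d-1-m) / ∏_{f ∤ a_i} (1 - η^(j a_i))`, where the `A_k` are the coefficients of
`∏_{f ∣ a_i} g(a_i s) * ∏_{f ∤ a_i} g(a_i s, η^(j a_i) / (1 - η^(j a_i)))`. -/
def waveRound {K : Type} (A : Arith K) (f : ℕ) (a : List ℕ) (pw rec ys B₀ : List K)
    (Bs : List (List K)) (j : ℕ) : Counted (List (List K)) := do
  let z ← A.natC 0
  let one ← A.natC 1
  let d := B₀.length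
  let Ak ← gtd A d B₀
    (((List.range' 1 (f - 1)).map fun c => ys.getD (j * c % f) z).zip Bs)
  let D ← foldC A.timesC one
    ((a.filter fun x => ¬ f ∣ x).map fun x => rec.getD (j * x % f) z)
  let V ← mapC (fun x => A.timesC x D) Ak.reverse
  mapC (fun i => mapC (fun v => A.timesC (pw.getD ((f - i * j % f) % f) z) v) V)
    (List.range' 1 f)

/-- The part of Algorithm Float-Denum that treats one divisor `f`. It returns the coefficients of
the polynomials `P_1, …, P_f`,
`P_i(t) = ∑_m (-1)^(d+m+1) t^m / (m! ∏_{f ∣ a_i} a_i) ∑_j η^(-ij) A_(d-1-m)(f, j) /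
  ∏_{f ∤ a_i} (1 - η^(j a_i))`. -/
def floatWave {K : Type} (A : Arith K) (f : ℕ) (a : List ℕ) : Counted (List (List K)) := do
  let z ← A.natC 0
  let one ← A.natC 1
  let B₀ ← mapC A.natC (a.filter fun x => f ∣ x)
  let Bs ← mapC (fun c => mapC A.natC (a.filter fun x => x % f = c)) (List.range' 1 (f - 1))
  let d := B₀.length
  let prodA ← foldC A.timesC one B₀
  let fact ← factorials A d 0 one
  let η ← A.rootC f
  let pw ← geom A η f one
  let rec' ← mapC (fun x => do
    let y ← A.minusC one x
    A.quotC one y) pw.tail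
  let ys' ← zipC A.timesC pw.tail rec'
  let V ← mapC (waveRound A f a pw (z :: rec') (z :: ys') B₀ Bs) (unitResidues f)
  let S ← foldC (zipC (zipC A.plusC)) (List.replicate f (List.replicate d z)) V
  mapC (fun row => zipC (fun m x => do
    let q ← A.timesC (fact.getD m z) prodA
    let y ← A.quotC x q
    if (d + m + 1) % 2 = 0 then pure y else A.minusC z y) (List.range d) row) S

/-- The set of all divisors of the entries of `a`. -/
def divisorSet (a : List ℕ) : Finset ℕ := a.toFinset.biUnion Nat.divisors

/-- Algorithm Float-Denum: the list of all divisors `f` of entries of `a`, each with the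
coefficients of the polynomials `P_1, …, P_f` of `W_f(t; a)`. -/
def floatDenum {K : Type} (A : Arith K) (a : List ℕ) :
    Counted (List (ℕ × List (List K))) :=
  mapC (fun f => do
    let W ← floatWave A f a
    pure (f, W)) ((divisorSet a).sort (· ≤ ·))

end FloatDenum

namespace FloatDenum

/-! ### Values and operation counts of the combinators -/

section Combinators

variable {α β γ K : Type}

@[simp] theorem pure_val (x : α) : (pure x : Counted α).val = x := rfl
@[simp] theorem pure_ops (x : α) : (pure x : Counted α).ops = 0 := rfl
@[simp] theorem bind_val (x : Counted α) (g : α → Counted β) :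
    (x >>= g).val = (g x.val).val := rfl
@[simp] theorem bind_ops (x : Counted α) (g : α → Counted β) :
    (x >>= g).ops = x.ops + (g x.val).ops := rfl

namespace Arith
variable (A : Arith K) (x y : K) (n : ℕ)
@[simp] theorem natC_val : (A.natC n).val = A.nat n := rfl
@[simp] theorem natC_ops : (A.natC n).ops = 1 := rfl
@[simp] theorem rootC_val : (A.rootC n).val = A.root n := rfl
@[simp] theorem rootC_ops : (A.rootC n).ops = 1 := rfl
@[simp] theorem plusC_val : (A.plusC x y).val = A.plus x y := rfl
@[simp] theorem plusC_ops : (A.plusC x y).ops = 1 := rfl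
@[simp] theorem minusC_val : (A.minusC x y).val = A.minus x y := rfl
@[simp] theorem minusC_ops : (A.minusC x y).ops = 1 := rfl
@[simp] theorem timesC_val : (A.timesC x y).val = A.times x y := rfl
@[simp] theorem timesC_ops : (A.timesC x y).ops = 1 := rfl
@[simp] theorem quotC_val : (A.quotC x y).val = A.quot x y := rfl
@[simp] theorem quotC_ops : (A.quotC x y).ops = 1 := rfl
end Arith

@[simp] theorem mapC_val (g : α → Counted β) (l : List α) :
    (mapC g l).val = l.map fun x => (g x).val := by
  induction l with
  | nil => rfl
  | cons x l ih => simp [mapC, ih]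

theorem mapC_ops (g : α → Counted β) (l : List α) :
    (mapC g l).ops = (l.map fun x => (g x).ops).sum := by
  induction l with
  | nil => rfl
  | cons x l ih => simp [mapC, ih]

theorem mapC_ops_le (g : α → Counted β) (l : List α) (c : ℕ) (h : ∀ x ∈ l, (g x).ops ≤ c) :
    (mapC g l).ops ≤ l.length * c := by
  rw [mapC_ops]
  simpa using List.sum_le_card_nsmul (l.map fun x => (g x).ops) c (by simpa using h)

@[simp] theorem zipC_val (g : α → β → Counted γ) (l : List α) (m : List β) :
    (zipC g l m).val = List.zipWith (fun x y => (g x y).val) l m := by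
  induction l generalizing m with
  | nil => rfl
  | cons x l ih =>
    cases m with
    | nil => rfl
    | cons y m => simp [zipC, ih]

theorem zipC_ops_le_left (g : α → β → Counted γ) (l : List α) (m : List β) (c n : ℕ)
    (h : ∀ x, ∀ y ∈ m, (g x y).ops ≤ c) (hn : l.length ≤ n) : (zipC g l m).ops ≤ n * c := by
  induction l generalizing m n with
  | nil => simp [zipC]
  | cons x l ih =>
    cases m with
    | nil => simp [zipC]
    | cons y m =>
      obtain ⟨n, rfl⟩ : ∃ k, n = k + 1 := ⟨n - 1, by simp at hn; omega⟩
      have h1 := ih m n (fun x y hy => h x y (by simp [hy])) (by simpa using hn)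
      have h2 := h x y (by simp)
      simp only [zipC, bind_ops, pure_ops]
      linarith

theorem zipC_ops_le_right (g : α → β → Counted γ) (l : List α) (m : List β) (c n : ℕ)
    (h : ∀ x, ∀ y ∈ m, (g x y).ops ≤ c) (hn : m.length ≤ n) : (zipC g l m).ops ≤ n * c := by
  induction l generalizing m n with
  | nil => simp [zipC]
  | cons x l ih =>
    cases m with
    | nil => simp [zipC]
    | cons y m =>
      obtain ⟨n, rfl⟩ : ∃ k, n = k + 1 := ⟨n - 1, by simp at hn; omega⟩
      have h1 := ih m n (fun x y hy => h x y (by simp [hy])) (by simpa using hn)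
      have h2 := h x y (by simp)
      simp only [zipC, bind_ops, pure_ops]
      linarith

@[simp] theorem foldC_val (g : β → α → Counted β) (s : β) (l : List α) :
    (foldC g s l).val = l.foldl (fun s x => (g s x).val) s := by
  induction l generalizing s with
  | nil => rfl
  | cons x l ih => simp [foldC, ih]

theorem foldC_ops_le (g : β → α → Counted β) (p : β → Prop) (c : α → ℕ) (l : List α) (s : β)
    (hs : p s) (h : ∀ s, p s → ∀ x ∈ l, p (g s x).val ∧ (g s x).ops ≤ c x) :
    (foldC g s l).ops ≤ (l.map c).sum := by
  induction l generalizing s with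
  | nil => simp [foldC]
  | cons x l ih =>
    obtain ⟨h1, h2⟩ := h s hs x (by simp)
    have h3 := ih _ h1 fun s hs y hy => h s hs y (by simp [hy])
    simp only [foldC, bind_ops, List.map_cons, List.sum_cons]
    omega

theorem foldC_induction (g : β → α → Counted β) (p : β → Prop) (l : List α) (s : β)
    (hs : p s) (h : ∀ s, p s → ∀ x ∈ l, p (g s x).val) : p (foldC g s l).val := by
  induction l generalizing s with
  | nil => exact hs
  | cons x l ih => exact ih _ (h s hs x (by simp)) fun s hs y hy => h s hs y (by simp [hy])

@[simp] theorem length_pad (n : ℕ) (z : K) (l : List K) : (pad n z l).length = n := by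
  simp [pad]; omega

theorem length_evens (l : List K) : (evens l).length = (l.length + 1) / 2 := by
  induction l using evens.induct with
  | case1 => simp [evens]
  | case2 => simp [evens]
  | case3 x y l ih => simp [evens, ih]; omega

end Combinators

/-! ### Operation counts -/

section Ops

variable {K : Type} (A : Arith K)

@[simp] theorem length_geom (w x : K) (n : ℕ) : (geom A w n x).val.length = n := by
  induction n generalizing x with
  | zero => rfl
  | succ n ih => simp [geom, ih]

@[simp] theorem geom_ops (w x : K) (n : ℕ) : (geom A w n x).ops = n := by
  induction n generalizing x with
  | zero => rfl
  | succ n ih => simp [geom, ih]; omega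

theorem length_fft (k : ℕ) (w : K) (l : List K) (hl : l.length = 2 ^ k) :
    (fft A k w l).val.length = 2 ^ k := by
  induction k generalizing w l with
  | zero => exact hl
  | succ k ih =>
    rw [pow_succ] at hl
    have h1 := fun w => ih w (evens l) (by rw [length_evens]; omega)
    have h2 := fun w => ih w (evens l.tail) (by rw [length_evens, List.length_tail]; omega)
    simp [fft, h1, h2, pow_succ]; omega

theorem fft_ops_le (k : ℕ) (w : K) (l : List K) :
    (fft A k w l).ops + 2 ≤ (2 * k + 2) * 2 ^ k := by
  induction k generalizing w l with
  | zero => simp [fft]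
  | succ k ih =>
    simp only [fft, bind_ops, pure_ops, Arith.timesC_ops, Arith.natC_ops, geom_ops, zipC_val]
    have h1 := fun w => ih w (evens l)
    have h2 := fun w => ih w (evens l.tail)
    have h3 := fun x y o => zipC_ops_le_left A.timesC (geom A x (2 ^ k) y).val o 1 (2 ^ k)
      (by simp) (by simp)
    have h4 := fun x y (o e : List K) => zipC_ops_le_right A.plusC e
      (List.zipWith (fun x y => (A.timesC x y).val) (geom A x (2 ^ k) y).val o) 1 (2 ^ k)
      (by simp) (by simp)
    have h5 := fun x y (o e : List K) => zipC_ops_le_right A.minusC e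
      (List.zipWith (fun x y => (A.timesC x y).val) (geom A x (2 ^ k) y).val o) 1 (2 ^ k)
      (by simp) (by simp)
    grw [h3, h4, h5]
    have h1 := h1 (A.timesC w w).val
    have h2 := h2 (A.timesC w w).val
    rw [pow_succ]
    linarith

@[simp] theorem length_seriesMul (n : ℕ) (p q : List K) : (seriesMul A n p q).val.length = n := by
  simp [seriesMul]

theorem seriesMul_ops_le (n k : ℕ) (p q : List K) (h : p.length + q.length ≤ 2 ^ k) :
    (seriesMul A n p q).ops ≤ (6 * k + 8) * 2 ^ k := by
  have hk : Nat.clog 2 (p.length + q.length) ≤ k := Nat.clog_le_of_le_pow h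
  simp only [seriesMul, bind_ops, pure_ops, Arith.rootC_ops, Arith.natC_ops, Arith.quotC_ops,
    zipC_val]
  generalize Nat.clog 2 (p.length + q.length) = j at hk
  have h1 := fun w l => fft_ops_le A j w l
  have h2 := fun w l => length_fft A j w (pad (2 ^ j) (A.natC 0).val l) (by simp)
  have h3 := fun w m => zipC_ops_le_left A.timesC (fft A j w (pad (2 ^ j) (A.natC 0).val p)).val
    m 1 (2 ^ j) (by simp) (h2 w p).le
  grw [h3, mapC_ops_le _ _ 1 (by simp)]
  rw [length_fft _ _ _ _ (by simp [length_fft])]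
  have h4 : (6 * j + 8) * 2 ^ j ≤ (6 * k + 8) * 2 ^ k := by gcongr; norm_num
  refine le_trans ?_ h4
  have e1 := h1 (A.rootC (2 ^ j)).val (pad (2 ^ j) (A.natC 0).val p)
  have e2 := h1 (A.rootC (2 ^ j)).val (pad (2 ^ j) (A.natC 0).val q)
  have e3 := h1 (A.quotC (A.natC 1).val (A.rootC (2 ^ j)).val).val
    (List.zipWith (fun x y => (A.timesC x y).val)
      (fft A j (A.rootC (2 ^ j)).val (pad (2 ^ j) (A.natC 0).val p)).val
      (fft A j (A.rootC (2 ^ j)).val (pad (2 ^ j) (A.natC 0).val q)).val)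
  linarith

@[simp] theorem length_seriesInv (p : List K) (k : ℕ) :
    (seriesInv A p k).val.length = 2 ^ k := by
  cases k <;> simp [seriesInv]

theorem seriesInv_ops_le (p : List K) (k : ℕ) :
    (seriesInv A p k).ops ≤ (48 * k + 164) * 2 ^ k := by
  induction k with
  | zero => simp [seriesInv]
  | succ k ih =>
    simp only [seriesInv, bind_ops, Arith.natC_ops]
    grw [ih, seriesMul_ops_le A _ (k + 2) _ _ (by simp [pow_succ]; omega),
      seriesMul_ops_le A _ (k + 2) _ _ (by simp [pow_succ]; omega),
      zipC_ops_le_left A.minusC _ _ 1 (2 ^ (k + 1)) (by simp) (by simp)]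
    have := Nat.one_le_two_pow (n := k)
    ring_nf
    nlinarith

@[simp] theorem length_seriesLog (n : ℕ) (p : List K) : (seriesLog A n p).val.length = n := by
  simp [seriesLog]

theorem seriesLog_ops_le (n k : ℕ) (p : List K) (hk : n ≤ 2 ^ k) :
    (seriesLog A n p).ops ≤ (60 * k + 196) * 2 ^ k := by
  have hk' : Nat.clog 2 n ≤ k := Nat.clog_le_of_le_pow hk
  simp only [seriesLog, bind_ops, pure_ops, Arith.natC_ops, zipC_val]
  grw [zipC_ops_le_left _ _ _ 2 (n - 1) (by simp) (by simp),
    zipC_ops_le_left _ _ _ 2 (n - 1) (by simp) (by simp), seriesInv_ops_le,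
    seriesMul_ops_le A _ (k + 1) _ _ (by simp [pow_succ]; omega), hk']
  · have := Nat.one_le_two_pow (n := k)
    have h2 : n - 1 ≤ 2 ^ k - 1 := by omega
    grw [h2]
    rw [pow_succ]
    have : (2 ^ k - 1) * 2 + 2 = 2 * 2 ^ k := by omega
    linarith
  · norm_num

theorem length_seriesExp (p : List K) (k : ℕ) : (seriesExp A p k).val.length = 2 ^ k := by
  cases k <;> simp [seriesExp]

theorem seriesExp_ops_le (p : List K) (k : ℕ) :
    (seriesExp A p k).ops ≤ (144 * k + 600) * 2 ^ k := by
  induction k with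
  | zero => simp [seriesExp]
  | succ k ih =>
    simp only [seriesExp, bind_ops, Arith.natC_ops]
    grw [ih, seriesMul_ops_le A _ (k + 2) _ _ (by simp [length_seriesExp, pow_succ]; omega),
      seriesLog_ops_le A _ (k + 1) _ le_rfl,
      zipC_ops_le_left A.minusC _ _ 1 (2 ^ (k + 1)) (by simp) (by simp),
      zipC_ops_le_left A.plusC _ _ 1 (2 ^ (k + 1)) (by simp) (by simp)]
    have := Nat.one_le_two_pow (n := k)
    ring_nf
    nlinarith

theorem length_linearProd (k : ℕ) (l : List K) (hl : l.length ≤ 2 ^ k) :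
    (linearProd A k l).val.length = l.length + 1 := by
  induction k generalizing l with
  | zero =>
    match l, hl with
    | [], _ => rfl
    | [b], _ => rfl
  | succ k ih =>
    rw [pow_succ] at hl
    have h1 := ih (l.take (2 ^ k)) (by simp)
    have h2 := ih (l.drop (2 ^ k)) (by simp; omega)
    simp [linearProd, h1, h2]
    omega

theorem linearProd_ops_le (k : ℕ) (l : List K) (hl : l.length ≤ 2 ^ k) :
    (linearProd A k l).ops ≤ (6 * k ^ 2 + 34 * k + 3) * 2 ^ k := by
  induction k generalizing l with
  | zero =>
    match l, hl with
    | [], _ => simp [linearProd]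
    | [b], _ => simp [linearProd]
  | succ k ih =>
    rw [pow_succ] at hl
    have := Nat.one_le_two_pow (n := k)
    have l1 : (l.take (2 ^ k)).length ≤ 2 ^ k := by simp
    have l2 : (l.drop (2 ^ k)).length ≤ 2 ^ k := by simp; omega
    simp only [linearProd, bind_ops]
    grw [ih _ l1, ih _ l2, seriesMul_ops_le A _ (k + 2) _ _ (by
      rw [length_linearProd A k _ l1, length_linearProd A k _ l2, pow_succ, pow_succ]; omega)]
    ring_nf
    nlinarith

end Ops

/-! ### Residue classes and blocks -/

@[to_additive]
theorem prod_map_filter_mod {M : Type*} [CommMonoid M] (F : ℕ → M) (f : ℕ) (hf : 0 < f)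
    (a : List ℕ) :
    ((List.range' 1 (f - 1)).map fun c => ((a.filter fun x => x % f = c).map F).prod).prod =
      ((a.filter fun x => ¬ f ∣ x).map F).prod := by
  induction a with
  | nil => simp
  | cons x a ih =>
    have h1 : ∀ c, (((x :: a).filter fun x => x % f = c).map F).prod =
        (if x % f = c then F x else 1) * ((a.filter fun x => x % f = c).map F).prod := by
      intro c
      by_cases h : x % f = c <;> simp [h]
    have h2 : (((x :: a).filter fun x => ¬ f ∣ x).map F).prod =
        (if f ∣ x then 1 else F x) * ((a.filter fun x => ¬ f ∣ x).map F).prod := by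
      by_cases h : f ∣ x <;> simp [h]
    simp only [h1, h2, List.prod_map_mul, ih]
    congr 1
    have h3 : ((List.range' 1 (f - 1)).map fun c => if x % f = c then F x else 1).prod =
        ∏ c ∈ (List.range' 1 (f - 1)).toFinset, if x % f = c then F x else 1 :=
      (List.prod_toFinset _ List.nodup_range').symm
    rw [h3, Finset.prod_ite_eq]
    have := Nat.mod_lt x hf
    by_cases h : f ∣ x
    · simp [h, Nat.mod_eq_zero_of_dvd h]
    · have : x % f ≠ 0 := fun h0 => h (Nat.dvd_of_mod_eq_zero h0)
      rw [if_neg h, if_pos]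
      simp only [List.mem_toFinset, List.mem_range'_1]
      omega

theorem flatten_blocks {K : Type} (d : ℕ) (hd : 0 < d) (l : List K) :
    (blocks d l).flatten = l := by
  have h : ∀ r, ((List.range r).map fun i => (l.drop (i * d)).take d).flatten =
      l.take (r * d) := by
    intro r
    induction r with
    | zero => simp
    | succ r ih => simp [List.range_succ, ih, Nat.succ_mul, List.take_add]
  rw [blocks, h, List.take_of_length_le]
  have := Nat.div_add_mod (l.length + d - 1) d
  have := Nat.mod_lt (l.length + d - 1) hd
  rw [mul_comm]
  omega

theorem length_blocks_mul_le {K : Type} (d : ℕ) (l : List K) :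
    (blocks d l).length * d ≤ l.length + d := by
  have := Nat.div_mul_le_self (l.length + d - 1) d
  simp only [blocks, List.length_map, List.length_range]
  omega

theorem length_le_of_mem_blocks {K : Type} {d : ℕ} {l b : List K} (h : b ∈ blocks d l) :
    b.length ≤ d := by
  simp only [blocks, List.mem_map] at h
  obtain ⟨r, -, rfl⟩ := h
  simp

theorem two_pow_clog_le {n : ℕ} (hn : 0 < n) : 2 ^ Nat.clog 2 n ≤ 2 * n := by
  rcases Nat.lt_or_ge n 2 with h | h
  · obtain rfl : n = 1 := by omega
    simp
  · have h1 := Nat.pow_pred_clog_lt_self (b := 2) (by norm_num) (x := n) (by omega)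
    have h2 : 0 < Nat.clog 2 n := Nat.clog_pos (by norm_num) h
    have h3 : 2 ^ Nat.clog 2 n = 2 * 2 ^ (Nat.clog 2 n).pred := by
      rw [← pow_succ']
      congr 1
      rw [Nat.pred_eq_sub_one]
      omega
    omega

theorem two_pow_clog_succ_le {d : ℕ} (hd : 0 < d) : 2 ^ Nat.clog 2 (d + 1) ≤ 2 * d := by
  have h1 := Nat.pow_pred_clog_lt_self (b := 2) (by norm_num) (x := d + 1) (by omega)
  have h2 : 0 < Nat.clog 2 (d + 1) := Nat.clog_pos (by norm_num) (by omega)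
  have h3 : 2 ^ Nat.clog 2 (d + 1) = 2 * 2 ^ (Nat.clog 2 (d + 1)).pred := by
    rw [← pow_succ']
    congr 1
    rw [Nat.pred_eq_sub_one]
    omega
  omega

/-! ### Operation counts of the main algorithm -/

section Ops

variable {K : Type} (A : Arith K)

theorem length_addSimilar_le (d : ℕ) (H B : List K) :
    (addSimilar A d H B).val.length ≤ d := by
  simp [addSimilar]

theorem seriesLog_ops_le_clog {d : ℕ} (hd : 0 < d) (p : List K) :
    (seriesLog A d p).ops ≤ 512 * (Nat.clog 2 (d + 1) * d) := by
  have h1 : d ≤ 2 ^ Nat.clog 2 (d + 1) := (Nat.le_succ d).trans (Nat.le_pow_clog (by norm_num) _)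
  have h2 : 0 < Nat.clog 2 (d + 1) := Nat.clog_pos (by norm_num) (by omega)
  grw [seriesLog_ops_le A d _ p h1, two_pow_clog_succ_le hd]
  nlinarith

theorem addSimilar_ops_le {d : ℕ} (hd : 0 < d) (H B : List K) :
    (addSimilar A d H B).ops ≤
      602 * (Nat.clog 2 (d + 1) ^ 2 * B.length) + 520 * (Nat.clog 2 (d + 1) * d) := by
  have hk : 0 < Nat.clog 2 (d + 1) := Nat.clog_pos (by norm_num) (by omega)
  have hL := fun p : List K => seriesLog_ops_le_clog A hd p
  set k := Nat.clog 2 (d + 1) with hkd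
  simp only [addSimilar, bind_ops, Arith.natC_ops]
  grw [foldC_ops_le _ (fun _ => True) (fun b => 86 * k ^ 2 * b.length + 516 * (k * d)) _ _ trivial
    ?_, zipC_ops_le_left _ _ _ 2 d (by simp) (by simp),
    zipC_ops_le_left _ _ _ 1 d (by simp) (by simp)]
  · have h1 : ((blocks d B).map fun b => 86 * k ^ 2 * b.length + 516 * (k * d)).sum =
        86 * k ^ 2 * B.length + (blocks d B).length * (516 * (k * d)) := by
      rw [List.sum_map_add, List.sum_map_mul_left, ← List.length_flatten, flatten_blocks d hd]
      simp
    rw [h1]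
    have h2 := length_blocks_mul_le d B
    have h3 : (blocks d B).length * (516 * (k * d)) ≤ 516 * k * (B.length + d) := by
      calc _ = 516 * k * ((blocks d B).length * d) := by ring
        _ ≤ _ := by gcongr
    grw [h3]
    have h4 : k * B.length ≤ k ^ 2 * B.length := by gcongr; nlinarith
    have h5 : d ≤ k * d := by nlinarith
    nlinarith
  · intro s _ b hb
    refine ⟨trivial, ?_⟩
    have hbd := length_le_of_mem_blocks hb
    simp only [bind_ops]
    grw [linearProd_ops_le A _ b (Nat.le_pow_clog (by norm_num) _), hL,
      zipC_ops_le_right _ _ _ 1 d (by simp) (by simp)]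
    have hj : Nat.clog 2 b.length ≤ k := Nat.clog_mono_right _ (by omega)
    have h5 : d ≤ k * d := by nlinarith
    have h6 : (6 * Nat.clog 2 b.length ^ 2 + 34 * Nat.clog 2 b.length + 3) *
        2 ^ Nat.clog 2 b.length ≤ 86 * k ^ 2 * b.length + 3 := by
      rcases Nat.eq_zero_or_pos b.length with h0 | h0
      · simp [h0]
      · have h2 := two_pow_clog_le h0
        grw [h2, hj]
        have : 6 * k ^ 2 + 34 * k + 3 ≤ 43 * k ^ 2 := by nlinarith
        grw [this]
        linarith
    have h7 : 3 ≤ 3 * (k * d) := by nlinarith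
    linarith

@[simp] theorem length_factorials (n i : ℕ) (x : K) : (factorials A n i x).val.length = n := by
  induction n generalizing i x with
  | zero => rfl
  | succ n ih => simp [factorials, ih]

theorem factorials_ops (n i : ℕ) (x : K) : (factorials A n i x).ops = 2 * n := by
  induction n generalizing i x with
  | zero => rfl
  | succ n ih => simp [factorials, ih]; omega

theorem lnTodd_ops_le {d : ℕ} (hd : 0 < d) :
    (lnTodd A d).ops ≤ 520 * (Nat.clog 2 (d + 1) * d) := by
  have hk : 0 < Nat.clog 2 (d + 1) := Nat.clog_pos (by norm_num) (by omega)
  simp only [lnTodd, bind_ops, Arith.natC_ops]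
  grw [factorials_ops, mapC_ops_le _ _ 1 (by simp), mapC_ops_le _ _ 1 (by simp),
    seriesLog_ops_le_clog A hd]
  simp only [List.length_tail, length_factorials, length_seriesLog]
  have h5 : d ≤ Nat.clog 2 (d + 1) * d := by nlinarith
  omega

theorem lnToddY_ops_le {d : ℕ} (hd : 0 < d) (y : K) :
    (lnToddY A d y).ops ≤ 520 * (Nat.clog 2 (d + 1) * d) := by
  have hk : 0 < Nat.clog 2 (d + 1) := Nat.clog_pos (by norm_num) (by omega)
  simp only [lnToddY, bind_ops, Arith.natC_ops]
  grw [factorials_ops, mapC_ops_le _ _ 2 (by simp), mapC_ops_le _ _ 1 (by simp),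
    seriesLog_ops_le_clog A hd]
  simp only [List.length_tail, length_factorials, length_seriesLog]
  have h5 : d ≤ Nat.clog 2 (d + 1) * d := by nlinarith
  omega

@[simp] theorem length_gtd (d : ℕ) (B₀ : List K) (Bs : List (K × List K)) :
    (gtd A d B₀ Bs).val.length = d := by
  simp [gtd]

theorem gtd_ops_le {d : ℕ} (hd : 0 < d) (B₀ : List K) (Bs : List (K × List K)) :
    (gtd A d B₀ Bs).ops ≤
      602 * (Nat.clog 2 (d + 1) ^ 2 * (B₀.length + (Bs.map fun yB => yB.2.length).sum)) +
        2600 * ((Bs.length + 1) * (Nat.clog 2 (d + 1) * d)) := by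
  have hk : 0 < Nat.clog 2 (d + 1) := Nat.clog_pos (by norm_num) (by omega)
  have hE : Nat.clog 2 d ≤ Nat.clog 2 (d + 1) := Nat.clog_mono_right _ (by omega)
  have hp : 2 ^ Nat.clog 2 d ≤ 2 * d :=
    (Nat.pow_le_pow_right (by norm_num) hE).trans (two_pow_clog_succ_le hd)
  simp only [gtd, bind_ops, Arith.natC_ops, pure_ops]
  grw [lnTodd_ops_le A hd, addSimilar_ops_le A hd, seriesExp_ops_le, hp, hE]
  grw [foldC_ops_le _ (fun s => s.length ≤ d) (fun yB => 602 * (Nat.clog 2 (d + 1) ^ 2) *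
    yB.2.length + 1041 * (Nat.clog 2 (d + 1) * d)) _ _ (length_addSimilar_le A _ _ _) ?_]
  · rw [List.sum_map_add, List.sum_map_mul_left]
    simp only [List.map_const', List.sum_replicate, smul_eq_mul]
    have h5 : d ≤ Nat.clog 2 (d + 1) * d := by nlinarith
    nlinarith
  · intro s hs yB _
    refine ⟨by simp [hs], ?_⟩
    simp only [bind_ops]
    grw [lnToddY_ops_le A hd, addSimilar_ops_le A hd,
      zipC_ops_le_left _ _ _ 1 d (by simp) hs]
    have h5 : d ≤ Nat.clog 2 (d + 1) * d := by nlinarith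
    linarith

theorem length_of_mem_waveRound (f : ℕ) (a : List ℕ) (pw rec ys B₀ : List K)
    (Bs : List (List K)) (j : ℕ) (row : List K)
    (h : row ∈ (waveRound A f a pw rec ys B₀ Bs j).val) : row.length = B₀.length := by
  simp only [waveRound, bind_val, mapC_val, List.mem_map] at h
  obtain ⟨i, -, rfl⟩ := h
  simp

theorem waveRound_ops_le (f : ℕ) (a : List ℕ) (pw rec ys B₀ : List K)
    (Bs : List (List K)) (j : ℕ) (hd : 0 < B₀.length) (hf : 0 < f) (hBs : Bs.length = f - 1)
    (ha : B₀.length + (Bs.map List.length).sum ≤ a.length) :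
    (waveRound A f a pw rec ys B₀ Bs j).ops ≤
      2604 * (f * (Nat.clog 2 (B₀.length + 1) * B₀.length)) +
        603 * (Nat.clog 2 (B₀.length + 1) ^ 2 * a.length) := by
  have hk : 0 < Nat.clog 2 (B₀.length + 1) := Nat.clog_pos (by norm_num) (by omega)
  simp only [waveRound, bind_ops, Arith.natC_ops]
  grw [gtd_ops_le A hd, foldC_ops_le _ (fun _ => True) (fun _ => 1) _ _ trivial (by simp),
    mapC_ops_le _ _ 1 (by simp), mapC_ops_le _ _ B₀.length fun x _ => by
      grw [mapC_ops_le _ _ 1 (by simp)]; simp]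
  set d := B₀.length
  have h0 : (List.map (fun yB : K × List K => yB.2.length)
      ((List.map (fun c => ys.getD (j * c % f) (A.natC 0).val) (List.range' 1 (f - 1))).zip
        Bs)).sum = (Bs.map List.length).sum := by
    rw [show (fun yB : K × List K => yB.2.length) = List.length ∘ Prod.snd from rfl,
      ← List.map_map, List.map_snd_zip (by simp [hBs])]
  rw [h0]
  have h1 : (a.filter fun x => ¬ f ∣ x).length ≤ a.length := List.length_filter_le _ _
  simp only [List.map_const', List.sum_replicate, smul_eq_mul, List.length_map, mul_one,
    List.length_reverse, length_gtd, List.length_zip, List.length_range', hBs, min_self]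
  grw [h1, ha, show f - 1 + 1 = f by omega]
  have h5 : d ≤ Nat.clog 2 (d + 1) * d := by nlinarith
  have h6 : f * d ≤ f * (Nat.clog 2 (d + 1) * d) := by gcongr
  have h7 : 1 ≤ f * d := Nat.mul_pos hf hd
  have h8 : d ≤ f * d := by nlinarith
  have h9 : a.length ≤ Nat.clog 2 (d + 1) ^ 2 * a.length := by
    have : 0 < Nat.clog 2 (d + 1) ^ 2 := by positivity
    nlinarith
  linarith

theorem length_unitResidues (f : ℕ) : (unitResidues f).length = Nat.totient f := by
  have h : (unitResidues f).toFinset = (Finset.Ico 1 (1 + f)).filter fun j => f.Coprime j := by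
    ext j
    simp [unitResidues, Nat.Coprime, Nat.gcd_comm f]
  rw [← Nat.filter_coprime_Ico_eq_totient f 1, ← h, List.toFinset_card_of_nodup]
  exact List.Nodup.filter _ List.nodup_range'

theorem mapC_natC_ops (l : List ℕ) : (mapC A.natC l).ops = l.length := by
  simp [mapC_ops]

theorem length_filter_dvd (f : ℕ) (a : List ℕ) :
    (a.filter fun x => f ∣ x).length = numDiv f a := by
  rw [numDiv, List.countP_eq_length_filter]

theorem floatWave_ops_le (f : ℕ) (a : List ℕ) (hf : 0 < f) (hd : 0 < numDiv f a) :
    (floatWave A f a).ops ≤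
      (2630 * (f * (Nat.clog 2 (numDiv f a + 1) * numDiv f a)) +
        604 * (Nat.clog 2 (numDiv f a + 1) ^ 2 * a.length)) * Nat.totient f := by
  have hk : 0 < Nat.clog 2 (numDiv f a + 1) := Nat.clog_pos (by norm_num) (by omega)
  have hφ : 0 < Nat.totient f := Nat.totient_pos.2 hf
  have hsum : numDiv f a + ((List.range' 1 (f - 1)).map fun c =>
      (a.filter fun x => x % f = c).length).sum = a.length := by
    have := sum_map_filter_mod (fun _ => 1) f hf a
    simp only [List.map_const', List.sum_replicate, smul_eq_mul, mul_one] at this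
    rw [this, ← length_filter_dvd]
    have := List.length_eq_length_filter_add (l := a) (fun x => decide (f ∣ x))
    simp at this ⊢
    omega
  have hBs : (mapC (fun c => mapC A.natC (a.filter fun x => x % f = c))
      (List.range' 1 (f - 1))).ops ≤ a.length := by
    rw [mapC_ops]
    simp only [mapC_natC_ops]
    omega
  have hB := length_filter_dvd f a
  simp only [floatWave, bind_ops, Arith.natC_ops, Arith.rootC_ops, geom_ops, mapC_val,
    factorials_ops, List.length_map]
  grw [hBs, mapC_natC_ops, mapC_ops_le (waveRound _ _ _ _ _ _ _ _) _ _
    fun x _ => waveRound_ops_le A _ _ _ _ _ _ _ _ (by simpa [hB] using hd) hf (by simp)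
      (by simpa [hB, Function.comp_def] using hsum.le),
    foldC_ops_le _ (fun _ => True) (fun _ => 1) _ _ trivial (by simp),
    mapC_ops_le _ _ 2 (by simp), zipC_ops_le_left _ _ _ 1 f (by simp) (by simp)]
  grw [foldC_ops_le (zipC (zipC A.plusC)) (fun s => s.length ≤ f)
    (fun _ => f * numDiv f a) _ _ (by simp) ?_]
  · grw [mapC_ops_le _ _ (numDiv f a * 3)]
    · have hS : ∀ V, (foldC (zipC (zipC A.plusC)) (List.replicate f
          (List.replicate (numDiv f a) (A.natC 0).val)) V).val.length ≤ f := fun V =>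
        foldC_induction _ (fun s : List (List K) => s.length ≤ f) _ _ (by simp) fun s hs x _ => by simp [hs]
      simp only [hB, List.map_const', List.sum_replicate, smul_eq_mul, List.length_map, mul_one,
        length_unitResidues, List.length_tail, length_geom]
      grw [hS]
      set d := numDiv f a
      set k := Nat.clog 2 (d + 1)
      have h1 : 1 ≤ f * d := Nat.mul_pos hf hd
      have h2 : d ≤ f * d := by nlinarith
      have h3 : f ≤ f * d := by nlinarith
      have h4 : f * d ≤ f * (k * d) := by gcongr; nlinarith
      have h5 : f * (k * d) ≤ f * (k * d) * Nat.totient f := Nat.le_mul_of_pos_right _ hφ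
      have h6 : a.length ≤ k ^ 2 * a.length := Nat.le_mul_of_pos_left _ (by positivity)
      have h7 : k ^ 2 * a.length ≤ k ^ 2 * a.length * Nat.totient f :=
        Nat.le_mul_of_pos_right _ hφ
      have h8 : Nat.totient f * (f * d) ≤ f * (k * d) * Nat.totient f := by
        rw [mul_comm]; gcongr
      have h9 : (f - 1) * 2 ≤ f * 2 := by omega
      grw [h9]
      linarith
    · intro row _
      grw [zipC_ops_le_left _ _ _ 3 (numDiv f a) _ (by simp [hB])]
      intro m x _
      simp only [bind_ops]
      split_ifs <;> simp
  · intro s hs m hm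
    simp only [List.mem_map] at hm
    obtain ⟨j, -, rfl⟩ := hm
    refine ⟨by simp [hs], ?_⟩
    refine (zipC_ops_le_left _ _ _ (numDiv f a) f ?_ hs)
    intro x y hy
    grw [zipC_ops_le_right _ _ _ 1 (numDiv f a) (by simp)]
    · simp
    · rw [length_of_mem_waveRound A _ _ _ _ _ _ _ _ _ hy]
      simp [hB]

theorem clog_le_log {d : ℕ} (hd : 0 < d) :
    (Nat.clog 2 (d + 1) : ℝ) ≤ 3 * Real.log (d + 1) := by
  have h1 : (2 : ℝ) ^ Nat.clog 2 (d + 1) ≤ (d + 1) ^ 2 := by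
    have h := two_pow_clog_succ_le hd
    have h2 : 2 ^ Nat.clog 2 (d + 1) ≤ (d + 1) ^ 2 := by nlinarith
    exact_mod_cast h2
  have h2 := Real.log_le_log (by positivity) h1
  rw [Real.log_pow, Real.log_pow] at h2
  have h3 := Real.log_two_gt_d9
  have h4 : (0 : ℝ) ≤ Nat.clog 2 (d + 1) := Nat.cast_nonneg _
  push_cast at h2
  nlinarith

end Ops

theorem numDiv_pos {f : ℕ} {a : List ℕ} (h : ∃ x ∈ a, f ∣ x) : 0 < numDiv f a :=
  List.countP_pos_iff.2 (by simpa using h)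

theorem floatWave_ops_le_log {K : Type} (A : Arith K) {f : ℕ} {a : List ℕ} (hf : 0 < f)
    (hd : 0 < numDiv f a) :
    ((floatWave A f a).ops : ℝ) ≤ 8000 * (((f : ℝ) * numDiv f a * Real.log (numDiv f a + 1) +
      (a.length : ℝ) * Real.log (numDiv f a + 1) ^ 2) * Nat.totient f) := by
  have h1 : ((floatWave A f a).ops : ℝ) ≤ ((2630 * (f * (Nat.clog 2 (numDiv f a + 1) * numDiv f a)) +
        604 * (Nat.clog 2 (numDiv f a + 1) ^ 2 * a.length)) * Nat.totient f : ℕ) :=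
    Nat.cast_le.2 (floatWave_ops_le A f a hf hd)
  push_cast at h1
  grw [h1, clog_le_log hd]
  have h2 : 0 ≤ (f : ℝ) * numDiv f a * Real.log (numDiv f a + 1) := by
    have : 0 ≤ Real.log (numDiv f a + 1) := Real.log_nonneg (by simp)
    positivity
  have h3 : 0 ≤ (a.length : ℝ) * Real.log (numDiv f a + 1) ^ 2 := by positivity
  rw [← mul_assoc (8000 : ℝ)]
  refine mul_le_mul_of_nonneg_right ?_ (Nat.cast_nonneg (α := ℝ) _)
  linarith

theorem numDiv_le_length (f : ℕ) (a : List ℕ) : numDiv f a ≤ a.length := List.countP_le_length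

theorem floatDenum_ops_le {K : Type} (A : Arith K) {M : ℕ} {a : List ℕ} (hpos : ∀ x ∈ a, 0 < x)
    (hM : ∀ x ∈ a, x ≤ M) :
    (floatDenum A a).ops ≤ M * ((2630 * (M * (a.length * a.length)) +
      604 * (a.length ^ 2 * a.length)) * M) := by
  have hmem : ∀ f ∈ divisorSet a, 0 < f ∧ f ≤ M ∧ 0 < numDiv f a := by
    intro f hf
    simp only [divisorSet, Finset.mem_biUnion, List.mem_toFinset, Nat.mem_divisors] at hf
    obtain ⟨x, hx, hfx, -⟩ := hf
    exact ⟨Nat.pos_of_dvd_of_pos hfx (hpos x hx), (Nat.le_of_dvd (hpos x hx) hfx).trans (hM x hx),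
      numDiv_pos ⟨x, hx, hfx⟩⟩
  have hcard : (divisorSet a).card ≤ M := by
    have : divisorSet a ⊆ Finset.Ioc 0 M := fun f hf =>
      Finset.mem_Ioc.2 ⟨(hmem f hf).1, (hmem f hf).2.1⟩
    simpa using Finset.card_le_card this
  rw [floatDenum]
  refine (mapC_ops_le _ _ ((2630 * (M * (a.length * a.length)) +
      604 * (a.length ^ 2 * a.length)) * M) ?_).trans ?_
  · intro f hf
    obtain ⟨h1, h2, h3⟩ := hmem f (by simpa using hf)
    have h4 := numDiv_le_length f a
    have h5 : Nat.clog 2 (numDiv f a + 1) ≤ a.length :=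
      (Nat.clog_le_of_le_pow (Nat.lt_two_pow_self (n := numDiv f a))).trans h4
    have h6 := Nat.totient_le f
    simp only [bind_ops, pure_ops, add_zero]
    grw [floatWave_ops_le A f a h1 h3, h5, h6, h4, h2]
  · rw [Finset.length_sort]
    gcongr

/-! ### Runs of the algorithm in two arithmetics -/

/-- The operations of the arithmetics `A` and `B` respect the relation `R`, where `Ok` singles out
admissible denominators of `B`. -/
structure Arith.Sim {K L : Type} (A : Arith K) (B : Arith L) (R : K → L → Prop)
    (Ok : L → Prop) : Prop where
  nat (n : ℕ) : R (A.nat n) (B.nat n)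
  root (n : ℕ) : 0 < n → R (A.root n) (B.root n)
  plus {x x' y y'} : R x x' → R y y' → R (A.plus x y) (B.plus x' y')
  minus {x x' y y'} : R x x' → R y y' → R (A.minus x y) (B.minus x' y')
  times {x x' y y'} : R x x' → R y y' → R (A.times x y) (B.times x' y')
  quot {x x' y y'} : R x x' → R y y' → Ok y' → R (A.quot x y) (B.quot x' y')
  ok_nat (n : ℕ) : 0 < n → Ok (B.nat n)
  ok_root (n : ℕ) : 0 < n → Ok (B.root n)
  ok_times {x y} : Ok x → Ok y → Ok (B.times x y)

open List

section Combinators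

variable {α α' β β' γ γ' : Type} {R : α → α' → Prop} {S : β → β' → Prop} {T : γ → γ' → Prop}

theorem mapC_rel {g : α → Counted β} {g' : α' → Counted β'} {l : List α} {l' : List α'}
    (hl : Forall₂ R l l') (h : ∀ x x', R x x' → S (g x).val (g' x').val) :
    Forall₂ S (mapC g l).val (mapC g' l').val := by
  rw [mapC_val, mapC_val]
  induction hl with
  | nil => exact .nil
  | cons h1 _ ih => exact .cons (h _ _ h1) ih

theorem zipC_rel {g : α → β → Counted γ} {g' : α' → β' → Counted γ'} {l : List α} {l' : List α'}
    {m : List β} {m' : List β'} (hl : Forall₂ R l l') (hm : Forall₂ S m m')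
    (h : ∀ x x', R x x' → ∀ y y', S y y' → T (g x y).val (g' x' y').val) :
    Forall₂ T (zipC g l m).val (zipC g' l' m').val := by
  rw [zipC_val, zipC_val]
  induction hl generalizing m m' with
  | nil => simp
  | cons h1 _ ih =>
    cases hm with
    | nil => simp
    | cons h2 hm => exact .cons (h _ _ h1 _ _ h2) (ih hm)

theorem foldC_rel {g : β → α → Counted β} {g' : β' → α' → Counted β'} {l : List α} {l' : List α'}
    {s : β} {s' : β'} (hs : S s s') (hl : Forall₂ R l l')
    (h : ∀ s s', S s s' → ∀ x x', R x x' → S (g s x).val (g' s' x').val) :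
    S (foldC g s l).val (foldC g' s' l').val := by
  induction hl generalizing s s' with
  | nil => exact hs
  | cons h1 _ ih => exact ih (h _ _ hs _ _ h1)

theorem replicate_rel {x : α} {x' : α'} (h : R x x') (n : ℕ) :
    Forall₂ R (replicate n x) (replicate n x') := by
  induction n with
  | zero => exact .nil
  | succ n ih => exact .cons h ih

theorem pad_rel {l : List α} {l' : List α'} {z : α} {z' : α'} (hl : Forall₂ R l l')
    (hz : R z z') (n : ℕ) : Forall₂ R (pad n z l) (pad n z' l') := by
  rw [pad, pad, hl.length_eq]
  exact rel_append (forall₂_take n hl) (replicate_rel hz _)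

theorem evens_rel {l : List α} {l' : List α'} (hl : Forall₂ R l l') :
    Forall₂ R (evens l) (evens l') := by
  induction l using evens.induct generalizing l' with
  | case1 => cases hl; exact .nil
  | case2 x => cases hl with | cons h hl => cases hl; exact .cons h .nil
  | case3 x y l ih =>
    cases hl with
    | cons h hl => cases hl with | cons h' hl => exact .cons h (ih hl)

theorem tail_rel {l : List α} {l' : List α'} (hl : Forall₂ R l l') :
    Forall₂ R l.tail l'.tail := by
  cases hl with
  | nil => exact .nil
  | cons _ h => exact h

theorem getD_rel {l : List α} {l' : List α'} {z : α} {z' : α'} (hl : Forall₂ R l l')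
    (hz : R z z') (i : ℕ) : R (l.getD i z) (l'.getD i z') := by
  induction hl generalizing i with
  | nil => simpa using hz
  | cons h _ ih => cases i with
    | zero => simpa using h
    | succ i => simpa using ih i

theorem getD_rel_of_lt {l : List α} {l' : List α'} {z : α} {z' : α'} (hl : Forall₂ R l l')
    (i : ℕ) (hi : i < l.length) : R (l.getD i z) (l'.getD i z') := by
  induction hl generalizing i with
  | nil => simp at hi
  | cons h _ ih => cases i with
    | zero => simpa using h
    | succ i => simpa using ih i (by simpa using hi)

theorem zip_rel {l : List α} {l' : List α'} {m : List β} {m' : List β'} (hl : Forall₂ R l l')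
    (hm : Forall₂ S m m') :
    Forall₂ (fun p q => R p.1 q.1 ∧ S p.2 q.2) (l.zip m) (l'.zip m') := by
  induction hl generalizing m m' with
  | nil => simp
  | cons h1 _ ih =>
    cases hm with
    | nil => simp
    | cons h2 hm => exact .cons ⟨h1, h2⟩ (ih hm)

theorem range_rel (n : ℕ) : Forall₂ (fun i j => i = j ∧ i < n) (range n) (range n) :=
  forall₂_same.2 fun _ hx => ⟨rfl, mem_range.1 hx⟩

theorem eq_rel (l : List α) : Forall₂ (fun x y => x = y) l l := forall₂_same.2 fun _ _ => rfl

theorem map_rel (l : List β) {g : β → α} {g' : β → α'} (h : ∀ x ∈ l, R (g x) (g' x)) :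
    Forall₂ R (l.map g) (l.map g') := by
  simpa [forall₂_map_left_iff, forall₂_map_right_iff, forall₂_same] using h

end Combinators

namespace Arith.Sim

variable {K L : Type} {A : Arith K} {B : Arith L} {R : K → L → Prop} {Ok : L → Prop}
  (h : A.Sim B R Ok)

include h

theorem zipC_plus {l l' m m'} (hl : Forall₂ R l l') (hm : Forall₂ R m m') :
    Forall₂ R (zipC A.plusC l m).val (zipC B.plusC l' m').val :=
  zipC_rel hl hm fun _ _ hx _ _ hy => h.plus hx hy

theorem zipC_minus {l l' m m'} (hl : Forall₂ R l l') (hm : Forall₂ R m m') :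
    Forall₂ R (zipC A.minusC l m).val (zipC B.minusC l' m').val :=
  zipC_rel hl hm fun _ _ hx _ _ hy => h.minus hx hy

theorem zipC_times {l l' m m'} (hl : Forall₂ R l l') (hm : Forall₂ R m m') :
    Forall₂ R (zipC A.timesC l m).val (zipC B.timesC l' m').val :=
  zipC_rel hl hm fun _ _ hx _ _ hy => h.times hx hy

theorem geom {w w' x x'} (hw : R w w') (hx : R x x') (n : ℕ) :
    Forall₂ R (geom A w n x).val (geom B w' n x').val := by
  induction n generalizing x x' with
  | zero => exact .nil
  | succ n ih => exact .cons hx (ih (h.times hx hw))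

theorem fft {w w' l l'} (hw : R w w') (hl : Forall₂ R l l') (k : ℕ) :
    Forall₂ R (fft A k w l).val (fft B k w' l').val := by
  induction k generalizing w w' l l' with
  | zero => exact hl
  | succ k ih =>
    have e := ih (h.times hw hw) (evens_rel hl)
    have o := ih (h.times hw hw) (evens_rel (tail_rel hl))
    have t := h.zipC_times (h.geom hw (h.nat 1) (2 ^ k)) o
    exact rel_append (h.zipC_plus e t) (h.zipC_minus e t)

theorem seriesMul {p p' q q'} (hp : Forall₂ R p p') (hq : Forall₂ R q q') (n : ℕ) :
    Forall₂ R (seriesMul A n p q).val (seriesMul B n p' q').val := by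
  simp only [FloatDenum.seriesMul, bind_val, hp.length_eq, hq.length_eq]
  generalize Nat.clog 2 (p'.length + q'.length) = k
  have hw := h.root (2 ^ k) (by positivity)
  refine pad_rel (mapC_rel (h.fft (h.quot (h.nat 1) hw (h.ok_root _ (by positivity)))
    (h.zipC_times (h.fft hw (pad_rel hp (h.nat 0) _) k) (h.fft hw (pad_rel hq (h.nat 0) _) k)) k)
    fun x x' hx => h.quot hx (h.nat _) (h.ok_nat _ (by positivity))) (h.nat 0) n

theorem seriesInv {p p'} (hp : Forall₂ R p p') (k : ℕ) :
    Forall₂ R (seriesInv A p k).val (seriesInv B p' k).val := by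
  induction k with
  | zero => exact .cons (h.nat 1) .nil
  | succ k ih =>
    simp only [FloatDenum.seriesInv, bind_val, Arith.natC_val]
    exact h.seriesMul ih (h.zipC_minus (pad_rel (.cons (h.nat 2) .nil) (h.nat 0) _)
      (h.seriesMul (pad_rel hp (h.nat 0) _) ih _)) _

theorem seriesLog {p p'} (hp : Forall₂ R p p') (n : ℕ) :
    Forall₂ R (seriesLog A n p).val (seriesLog B n p').val := by
  have hp := pad_rel hp (h.nat 0) n
  simp only [FloatDenum.seriesLog, bind_val, pure_val, Arith.natC_val]
  refine pad_rel (.cons (h.nat 0) (zipC_rel (range_rel _) (h.seriesMul (zipC_rel (range_rel _)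
    (tail_rel hp) ?_) (pad_rel (h.seriesInv hp _) (h.nat 0) _) _) ?_)) (h.nat 0) n
  · rintro i _ ⟨rfl, -⟩ y y' hy
    exact h.times (h.nat _) hy
  · rintro i _ ⟨rfl, -⟩ y y' hy
    exact h.quot hy (h.nat _) (h.ok_nat _ (by positivity))

theorem seriesExp {p p'} (hp : Forall₂ R p p') (k : ℕ) :
    Forall₂ R (seriesExp A p k).val (seriesExp B p' k).val := by
  induction k with
  | zero => exact .cons (h.nat 1) .nil
  | succ k ih =>
    simp only [FloatDenum.seriesExp, bind_val, Arith.natC_val]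
    exact h.seriesMul ih (h.zipC_plus (pad_rel (.cons (h.nat 1) .nil) (h.nat 0) _)
      (h.zipC_minus (pad_rel hp (h.nat 0) _) (h.seriesLog ih _))) _

theorem linearProd {l l'} (hl : Forall₂ R l l') (k : ℕ) :
    Forall₂ R (linearProd A k l).val (linearProd B k l').val := by
  induction k generalizing l l' with
  | zero =>
    cases hl with
    | nil => exact .cons (h.nat 1) .nil
    | cons hb _ => exact .cons (h.nat 1) (.cons (h.minus (h.nat 0) hb) .nil)
  | succ k ih =>
    have h1 := ih (forall₂_take (2 ^ k) hl)
    have h2 := ih (forall₂_drop (2 ^ k) hl)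
    simp only [FloatDenum.linearProd, bind_val, h1.length_eq, h2.length_eq]
    exact h.seriesMul h1 h2 _

omit h in
theorem _root_.FloatDenum.blocks_rel {l l'} (hl : Forall₂ R l l') (d : ℕ) :
    Forall₂ (Forall₂ R) (blocks d l) (blocks d l') := by
  rw [blocks, blocks, hl.length_eq]
  exact map_rel _ fun r _ => forall₂_take _ (forall₂_drop _ hl)

theorem addSimilar {H H' l l'} (hH : Forall₂ R H H') (hl : Forall₂ R l l') (d : ℕ) :
    Forall₂ R (addSimilar A d H l).val (addSimilar B d H' l').val := by
  simp only [FloatDenum.addSimilar, bind_val, Arith.natC_val]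
  refine h.zipC_times (zipC_rel (range_rel _) (foldC_rel (S := Forall₂ R) (replicate_rel
    (h.nat 0) d) (blocks_rel hl d) ?_) ?_) hH
  · intro s s' hs b b' hb
    simp only [bind_val, hb.length_eq]
    exact h.zipC_minus hs (h.seriesLog (h.linearProd hb _) d)
  · rintro i _ ⟨rfl, -⟩ y y' hy
    exact h.times (h.nat _) hy

theorem factorials {x x'} (hx : R x x') (ok : Ok x') (n i : ℕ) :
    Forall₂ (fun x y => R x y ∧ Ok y) (factorials A n i x).val (factorials B n i x').val := by
  induction n generalizing i x x' with
  | zero => exact .nil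
  | succ n ih =>
    exact .cons ⟨hx, ok⟩ (ih (h.times hx (h.nat _)) (h.ok_times ok (h.ok_nat _ (by positivity))) _)

theorem lnTodd (d : ℕ) : Forall₂ R (lnTodd A d).val (lnTodd B d).val :=
  mapC_rel (h.seriesLog (mapC_rel (tail_rel (h.factorials (h.nat 1) (h.ok_nat 1 one_pos) _ _))
    fun _ _ hx => h.quot (h.nat 1) hx.1 hx.2) d) fun _ _ hx => h.minus (h.nat 0) hx

theorem lnToddY {y y'} (hy : R y y') (d : ℕ) :
    Forall₂ R (lnToddY A d y).val (lnToddY B d y').val :=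
  mapC_rel (h.seriesLog (.cons (h.nat 1) (mapC_rel (tail_rel (h.factorials (h.nat 1)
    (h.ok_nat 1 one_pos) _ _)) fun _ _ hx => h.minus (h.nat 0) (h.quot hy hx.1 hx.2))) d)
    fun _ _ hx => h.minus (h.nat 0) hx

theorem gtd {l l' m m'} (hl : Forall₂ R l l')
    (hm : Forall₂ (fun p q => R p.1 q.1 ∧ Forall₂ R p.2 q.2) m m') (d : ℕ) :
    Forall₂ R (gtd A d l m).val (gtd B d l' m').val := by
  refine pad_rel (h.seriesExp (foldC_rel (h.addSimilar (h.lnTodd d) hl d) hm ?_) _) (h.nat 0) d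
  intro s s' hs p q hpq
  exact h.zipC_plus hs (h.addSimilar (h.lnToddY hpq.1 d) hpq.2 d)

theorem waveRound {f : ℕ} {a : List ℕ} {pw pw' rec rec' ys ys' l l' m m'}
    (hpw : Forall₂ R pw pw') (hrec : Forall₂ R rec rec') (hys : Forall₂ R ys ys')
    (hl : Forall₂ R l l') (hm : Forall₂ (Forall₂ R) m m') (j : ℕ) :
    Forall₂ (Forall₂ R) (waveRound A f a pw rec ys l m j).val
      (waveRound B f a pw' rec' ys' l' m' j).val := by
  simp only [FloatDenum.waveRound, bind_val, hl.length_eq]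
  have z := h.nat 0
  refine mapC_rel (eq_rel _) (S := Forall₂ R) ?_
  rintro i _ rfl
  refine mapC_rel (mapC_rel (rel_reverse (h.gtd hl (zip_rel (map_rel _ fun c _ =>
    getD_rel hys z _) hm) _)) fun x x' hx => h.times hx (foldC_rel (h.nat 1) (map_rel _ fun c _ =>
    getD_rel hrec z _) fun s s' hs x x' hx => h.times hs hx)) fun x x' hx =>
    h.times (getD_rel hpw z _) hx

theorem floatWave {f : ℕ} {a : List ℕ} (hf : 0 < f) (ha : ∀ x ∈ a, 0 < x)
    (hη : ∀ y ∈ (FloatDenum.geom B (B.root f) f (B.nat 1)).val.tail, Ok (B.minus (B.nat 1) y)) :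
    Forall₂ (Forall₂ R) (floatWave A f a).val (floatWave B f a).val := by
  have z := h.nat 0
  have pw := h.geom (h.root f hf) (h.nat 1) f
  have hl : Forall₂ (fun x y => R x y ∧ Ok y) (mapC A.natC (a.filter fun x => f ∣ x)).val
      (mapC B.natC (a.filter fun x => f ∣ x)).val := by
    simp only [mapC_val]
    exact map_rel _ fun x hx => ⟨h.nat x, h.ok_nat x (ha x (mem_of_mem_filter hx))⟩
  have hl' := hl.imp fun _ _ hx => hx.1
  have hm : Forall₂ (Forall₂ R)
      (mapC (fun c => mapC A.natC (a.filter fun x => x % f = c)) (range' 1 (f - 1))).val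
      (mapC (fun c => mapC B.natC (a.filter fun x => x % f = c)) (range' 1 (f - 1))).val := by
    simp only [mapC_val]
    exact map_rel _ fun c _ => map_rel _ fun x _ => h.nat x
  have hprod : R (foldC A.timesC (A.nat 1) (mapC A.natC (a.filter fun x => f ∣ x)).val).val
      (foldC B.timesC (B.nat 1) (mapC B.natC (a.filter fun x => f ∣ x)).val).val ∧
      Ok (foldC B.timesC (B.nat 1) (mapC B.natC (a.filter fun x => f ∣ x)).val).val :=
    foldC_rel (S := fun x y => R x y ∧ Ok y) ⟨h.nat 1, h.ok_nat 1 one_pos⟩ hl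
      fun s s' hs x x' hx => ⟨h.times hs.1 hx.1, h.ok_times hs.2 hx.2⟩
  have hrec : Forall₂ R (mapC (fun x => do
        let y ← A.minusC (A.nat 1) x
        A.quotC (A.nat 1) y) (FloatDenum.geom A (A.root f) f (A.nat 1)).val.tail).val
      (mapC (fun x => do
        let y ← B.minusC (B.nat 1) x
        B.quotC (B.nat 1) y) (FloatDenum.geom B (B.root f) f (B.nat 1)).val.tail).val := by
    refine mapC_rel (R := fun x y => R x y ∧ Ok (B.minus (B.nat 1) y)) ?_
      fun x x' hx => h.quot (h.nat 1) (h.minus (h.nat 1) hx.1) hx.2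
    have := tail_rel pw
    generalize (FloatDenum.geom A (A.root f) f (A.nat 1)).val.tail = u at this
    generalize (FloatDenum.geom B (B.root f) f (B.nat 1)).val.tail = v at this hη
    induction this with
    | nil => exact .nil
    | cons hx _ ih => exact .cons ⟨hx, hη _ (by simp)⟩ (ih fun y hy => hη y (by simp [hy]))
  have hys := h.zipC_times (tail_rel pw) hrec
  have hV := fun j => h.waveRound (f := f) (a := a) pw (.cons z hrec) (.cons z hys) hl' hm j
  simp only [FloatDenum.floatWave, bind_val, Arith.natC_val, Arith.rootC_val]
  have hlen := hl.length_eq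
  rw [← hlen]
  refine mapC_rel (foldC_rel (S := Forall₂ (Forall₂ R)) (replicate_rel (replicate_rel z _) f)
    (mapC_rel (eq_rel _) (S := Forall₂ (Forall₂ R)) fun j _ hj => hj ▸ hV j)
    fun s s' hs V V' hV => zipC_rel hs hV fun _ _ h1 _ _ h2 => h.zipC_plus h1 h2) ?_
  intro row row' hrow
  refine zipC_rel (range_rel _) hrow ?_
  rintro m _ ⟨rfl, hm⟩ y y' hy
  have hfact := getD_rel_of_lt (z := A.nat 0) (z' := B.nat 0) (h.factorials (h.nat 1)
    (h.ok_nat 1 one_pos)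
    (mapC A.natC (a.filter fun x => f ∣ x)).val.length 0) m (by simpa using hm)
  have hq := h.quot hy (h.times hfact.1 hprod.1) (h.ok_times hfact.2 hprod.2)
  simp only [bind_val]
  split_ifs
  · exact hq
  · exact h.minus z hq

end Arith.Sim

/-! ### Truncated power series as lists -/

section Series

/-- The list of the first `n` coefficients of a power series. -/
noncomputable def coeffs (n : ℕ) (F : PowerSeries ℂ) : List ℂ :=
  (List.range n).map fun k => PowerSeries.coeff k F

/-- The power series with a given list of coefficients. -/
noncomputable def ser (l : List ℂ) : PowerSeries ℂ := PowerSeries.mk fun k => l.getD k 0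

theorem coeff_ser (k : ℕ) (l : List ℂ) : PowerSeries.coeff k (ser l) = l.getD k 0 := by
  simp [ser]

@[simp] theorem length_coeffs (n : ℕ) (F : PowerSeries ℂ) : (coeffs n F).length = n := by
  simp [coeffs]

theorem coeffs_eq_iff {n : ℕ} {F G : PowerSeries ℂ} :
    coeffs n F = coeffs n G ↔ PowerSeries.X ^ n ∣ F - G := by
  rw [PowerSeries.X_pow_dvd_iff]
  simp [coeffs, sub_eq_zero]

theorem getD_coeffs (n k : ℕ) (F : PowerSeries ℂ) :
    (coeffs n F).getD k 0 = if k < n then PowerSeries.coeff k F else 0 := by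
  rw [List.getD_eq_getElem?_getD]
  split_ifs with h
  · simp [coeffs, h]
  · simp [coeffs, not_lt.1 h]

theorem X_pow_dvd_ser_coeffs (n : ℕ) (F : PowerSeries ℂ) :
    PowerSeries.X ^ n ∣ ser (coeffs n F) - F := by
  rw [PowerSeries.X_pow_dvd_iff]
  intro k hk
  rw [map_sub, coeff_ser, getD_coeffs, if_pos hk, sub_self]

theorem exists_ser_coeffs (n : ℕ) (F : PowerSeries ℂ) :
    ∃ u, ser (coeffs n F) = F + PowerSeries.X ^ n * u := by
  obtain ⟨u, hu⟩ := X_pow_dvd_ser_coeffs n F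
  exact ⟨u, by linear_combination hu⟩

theorem pad_eq_coeffs (n : ℕ) (l : List ℂ) : pad n 0 l = coeffs n (ser l) := by
  apply List.ext_getElem
  · simp
  · intro i h1 h2
    simp only [length_coeffs] at h2
    by_cases h : i < l.length
    · simp [pad, coeffs, coeff_ser, h, h2]
    · simp [pad, coeffs, coeff_ser, not_lt.1 h, h]

theorem pad_coeffs (n : ℕ) (F : PowerSeries ℂ) : pad n 0 (coeffs n F) = coeffs n F := by
  simp [pad]

theorem zipWith_map_range {α β γ : Type*} (g : α → β → γ) (u : ℕ → α) (v : ℕ → β) (n : ℕ) :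
    List.zipWith g ((List.range n).map u) ((List.range n).map v) =
      (List.range n).map fun i => g (u i) (v i) := by
  rw [List.zipWith_map, List.zipWith_self]

theorem zipWith_range_map {β γ : Type*} (g : ℕ → β → γ) (v : ℕ → β) (n : ℕ) :
    List.zipWith g (List.range n) ((List.range n).map v) =
      (List.range n).map fun i => g i (v i) := by
  simpa using zipWith_map_range g id v n

theorem zipWith_add_coeffs (n : ℕ) (F G : PowerSeries ℂ) :
    List.zipWith (fun x y => x + y) (coeffs n F) (coeffs n G) = coeffs n (F + G) := by
  rw [coeffs, coeffs, zipWith_map_range]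
  simp [coeffs]

theorem zipWith_sub_coeffs (n : ℕ) (F G : PowerSeries ℂ) :
    List.zipWith (fun x y => x - y) (coeffs n F) (coeffs n G) = coeffs n (F - G) := by
  rw [coeffs, coeffs, zipWith_map_range]
  simp [coeffs]

theorem replicate_zero_eq_coeffs (n : ℕ) : List.replicate n (0 : ℂ) = coeffs n 0 := by
  simp [coeffs, List.map_const']

end Series

/-! ### Exact arithmetic -/

namespace Arith

@[simp] theorem exact_nat (n : ℕ) : exact.nat n = n := rfl
@[simp] theorem exact_root (n : ℕ) :
    exact.root n = Complex.exp (2 * Real.pi * Complex.I / n) := rfl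
@[simp] theorem exact_plus (x y : ℂ) : exact.plus x y = x + y := rfl
@[simp] theorem exact_minus (x y : ℂ) : exact.minus x y = x - y := rfl
@[simp] theorem exact_times (x y : ℂ) : exact.times x y = x * y := rfl
@[simp] theorem exact_quot (x y : ℂ) : exact.quot x y = x / y := rfl

end Arith

open Arith (exact)

theorem geom_exact (w x : ℂ) (n : ℕ) :
    (geom exact w n x).val = (List.range n).map fun i => x * w ^ i := by
  induction n generalizing x with
  | zero => rfl
  | succ n ih =>
    simp [geom, ih, List.range_succ_eq_map, pow_succ', mul_assoc, Function.comp_def]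

theorem getD_evens {K : Type} (l : List K) (z : K) (j : ℕ) :
    (evens l).getD j z = l.getD (2 * j) z := by
  induction l using evens.induct generalizing j with
  | case1 => simp [evens]
  | case2 x => cases j <;> simp [evens, Nat.mul_succ]
  | case3 x y l ih =>
    cases j with
    | zero => simp [evens]
    | succ j => simpa [evens, Nat.mul_succ] using ih j

theorem sum_range_two_mul {M : Type*} [AddCommMonoid M] (g : ℕ → M) (n : ℕ) :
    ∑ j ∈ Finset.range (2 * n), g j =
      ∑ j ∈ Finset.range n, g (2 * j) + ∑ j ∈ Finset.range n, g (2 * j + 1) := by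
  induction n with
  | zero => simp
  | succ n ih =>
    rw [Nat.mul_succ, Finset.sum_range_succ, Finset.sum_range_succ, ih, Finset.sum_range_succ,
      Finset.sum_range_succ]
    abel

theorem fft_exact (k : ℕ) (w : ℂ) (hw : IsPrimitiveRoot w (2 ^ k)) (l : List ℂ)
    (hl : l.length = 2 ^ k) :
    (fft exact k w l).val = (List.range (2 ^ k)).map fun i =>
      ∑ j ∈ Finset.range (2 ^ k), l.getD j 0 * w ^ (i * j) := by
  induction k generalizing w l with
  | zero =>
    match l, hl with
    | [x], _ => simp [fft]
  | succ k ih =>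
    have hw2 : IsPrimitiveRoot (w * w) (2 ^ k) := by
      have := hw.pow (by positivity) (pow_succ' 2 k)
      rwa [pow_two] at this
    have hn : w ^ 2 ^ k = -1 :=
      (hw.pow (by positivity) (pow_succ 2 k)).eq_neg_one_of_two_right
    rw [pow_succ] at hl
    have he := ih (w * w) hw2 (evens l) (by rw [length_evens]; omega)
    have ho := ih (w * w) hw2 (evens l.tail) (by rw [length_evens, List.length_tail]; omega)
    have htail : ∀ j, l.tail.getD j 0 = l.getD (j + 1) 0 := by
      intro j
      cases l <;> simp
    simp only [fft, bind_val, pure_val, zipC_val, Arith.timesC_val, Arith.exact_times,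
      Arith.natC_val, Arith.exact_nat, Arith.plusC_val, Arith.minusC_val, Arith.exact_plus,
      Arith.exact_minus, he, ho, geom_exact, zipWith_map_range, getD_evens, htail]
    rw [pow_succ' 2 k, two_mul, List.range_add, List.map_append, List.map_map]
    congr 1 <;>
    · refine List.map_congr_left fun i _ => ?_
      try simp only [Function.comp_apply]
      rw [← two_mul, sum_range_two_mul]
      simp only [Finset.mul_sum, Nat.cast_one, one_mul, sub_eq_add_neg,
        ← Finset.sum_neg_distrib]
      congr 1 <;>
      · refine Finset.sum_congr rfl fun j _ => ?_
        simp only [← pow_two, ← pow_mul, add_mul, mul_add, pow_add, pow_mul w (2 ^ k), hn]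
        ring_nf
        try simp

theorem isPrimitiveRoot_exact_root (n : ℕ) (hn : 0 < n) : IsPrimitiveRoot (exact.root n) n :=
  Complex.isPrimitiveRoot_exp n hn.ne'

theorem sum_pow_mul_inv_pow {N : ℕ} {w : ℂ} (hw : IsPrimitiveRoot w N) {i m : ℕ} (hi : i < N)
    (hm : m < N) :
    ∑ j ∈ Finset.range N, w ^ (j * m) * w⁻¹ ^ (i * j) = if i = m then (N : ℂ) else 0 := by
  have h0 : w ≠ 0 := hw.ne_zero (by omega)
  have h1 : ∀ j, w ^ (j * m) * w⁻¹ ^ (i * j) = (w ^ m * w⁻¹ ^ i) ^ j := by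
    intro j
    rw [mul_pow, ← pow_mul, ← pow_mul, mul_comm j m]
  simp only [h1]
  split_ifs with h
  · subst h
    simp only [← mul_pow, mul_inv_cancel₀ h0]
    simp
  · have h2 : w ^ m * w⁻¹ ^ i ≠ 1 := by
      intro h3
      apply h
      apply hw.pow_inj hi hm
      rw [inv_pow] at h3
      field_simp at h3
      exact h3.symm
    have h3 : (w ^ m * w⁻¹ ^ i) ^ N = 1 := by
      rw [mul_pow, pow_right_comm, pow_right_comm w⁻¹, inv_pow, hw.pow_eq_one]
      simp
    have h4 := mul_geom_sum (w ^ m * w⁻¹ ^ i) N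
    rw [h3, sub_self] at h4
    exact (mul_eq_zero.1 h4).resolve_left (sub_ne_zero.2 h2)

theorem fft_inverse (k : ℕ) (w : ℂ) (hw : IsPrimitiveRoot w (2 ^ k)) (c : ℕ → ℂ) :
    ((fft exact k w⁻¹ ((List.range (2 ^ k)).map fun i =>
      ∑ j ∈ Finset.range (2 ^ k), c j * w ^ (i * j))).val.map fun x : ℂ => x / (2 ^ k : ℕ)) =
      (List.range (2 ^ k)).map c := by
  rw [fft_exact k _ hw.inv _ (by simp), List.map_map]
  refine List.map_congr_left fun i hi => ?_
  rw [List.mem_range] at hi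
  have h1 : ∀ j ∈ Finset.range (2 ^ k), ((List.range (2 ^ k)).map fun i =>
      ∑ j ∈ Finset.range (2 ^ k), c j * w ^ (i * j)).getD j 0 * w⁻¹ ^ (i * j) =
      ∑ m ∈ Finset.range (2 ^ k), c m * (w ^ (j * m) * w⁻¹ ^ (i * j)) := by
    intro j hj
    rw [Finset.mem_range] at hj
    rw [List.getD_eq_getElem?_getD]
    simp [hj, Finset.sum_mul, mul_assoc]
  rw [Function.comp_apply, Finset.sum_congr rfl h1, Finset.sum_comm]
  have h2 : ∀ m ∈ Finset.range (2 ^ k), ∑ j ∈ Finset.range (2 ^ k),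
      c m * (w ^ (j * m) * w⁻¹ ^ (i * j)) = if i = m then c m * (2 ^ k : ℕ) else 0 := by
    intro m hm
    rw [← Finset.mul_sum, sum_pow_mul_inv_pow hw hi (Finset.mem_range.1 hm)]
    simp
  rw [Finset.sum_congr rfl h2, Finset.sum_ite_eq, if_pos (Finset.mem_range.2 hi)]
  exact mul_div_cancel_right₀ _ (Nat.cast_ne_zero.2 (Nat.two_pow_pos k).ne')

theorem coe_trunc_ser (l : List ℂ) :
    ((PowerSeries.trunc l.length (ser l) : ℂ[X]) : PowerSeries ℂ) = ser l := by
  ext k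
  rw [Polynomial.coeff_coe, PowerSeries.coeff_trunc, coeff_ser]
  split_ifs with h
  · rfl
  · rw [List.getD_eq_default _ _ (not_lt.1 h)]

theorem natDegree_trunc_mul_trunc_lt (p q : List ℂ) {N : ℕ} (hN : 0 < N)
    (h : p.length + q.length ≤ N) :
    (PowerSeries.trunc p.length (ser p) * PowerSeries.trunc q.length (ser q)).natDegree < N := by
  by_cases hp : PowerSeries.trunc p.length (ser p) = 0
  · simpa [hp] using hN
  by_cases hq : PowerSeries.trunc q.length (ser q) = 0
  · simpa [hq] using hN
  rw [Polynomial.natDegree_mul hp hq]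
  have h1 := (Polynomial.natDegree_lt_iff_degree_lt hp).2 (PowerSeries.degree_trunc_lt (ser p) _)
  have h2 := (Polynomial.natDegree_lt_iff_degree_lt hq).2 (PowerSeries.degree_trunc_lt (ser q) _)
  omega

theorem coeff_trunc_mul_trunc (p q : List ℂ) (m : ℕ) :
    (PowerSeries.trunc p.length (ser p) * PowerSeries.trunc q.length (ser q)).coeff m =
      PowerSeries.coeff m (ser p * ser q) := by
  rw [← Polynomial.coeff_coe, Polynomial.coe_mul, coe_trunc_ser, coe_trunc_ser]

theorem sum_pad_eq_eval (p : List ℂ) {N : ℕ} (h : p.length ≤ N) (x : ℂ) :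
    ∑ j ∈ Finset.range N, (pad N 0 p).getD j 0 * x ^ j =
      (PowerSeries.trunc p.length (ser p)).eval x := by
  have h1 : ∀ j ∈ Finset.range N, (pad N 0 p).getD j 0 * x ^ j =
      (PowerSeries.trunc p.length (ser p)).coeff j * x ^ j := by
    intro j hj
    rw [pad_eq_coeffs, getD_coeffs, if_pos (Finset.mem_range.1 hj), ← Polynomial.coeff_coe,
      coe_trunc_ser]
  rw [Finset.sum_congr rfl h1]
  by_cases h0 : PowerSeries.trunc p.length (ser p) = 0
  · simp [h0]
  · refine (Polynomial.eval_eq_sum_range' ?_ x).symm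
    exact ((Polynomial.natDegree_lt_iff_degree_lt h0).2
      (PowerSeries.degree_trunc_lt (ser p) _)).trans_le h

theorem seriesMul_exact (n : ℕ) (p q : List ℂ) :
    (seriesMul exact n p q).val = coeffs n (ser p * ser q) := by
  simp only [seriesMul, bind_val, pure_val, Arith.natC_val, Arith.rootC_val, zipC_val, mapC_val,
    Arith.quotC_val, Arith.timesC_val, Arith.exact_times, Arith.exact_quot, Arith.exact_nat,
    Nat.cast_zero, Nat.cast_one, one_div]
  have hk : p.length + q.length ≤ 2 ^ Nat.clog 2 (p.length + q.length) :=
    Nat.le_pow_clog (by norm_num) _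
  generalize Nat.clog 2 (p.length + q.length) = k at hk
  have hw := isPrimitiveRoot_exact_root (2 ^ k) (by positivity)
  generalize exact.root (2 ^ k) = w at hw
  rw [fft_exact k w hw _ (by simp), fft_exact k w hw _ (by simp), zipWith_map_range]
  have h1 : ∀ i, (∑ j ∈ Finset.range (2 ^ k), (pad (2 ^ k) 0 p).getD j 0 * w ^ (i * j)) *
      (∑ j ∈ Finset.range (2 ^ k), (pad (2 ^ k) 0 q).getD j 0 * w ^ (i * j)) =
      ∑ j ∈ Finset.range (2 ^ k), PowerSeries.coeff j (ser p * ser q) * w ^ (i * j) := by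
    intro i
    simp only [pow_mul]
    rw [sum_pad_eq_eval p (by omega), sum_pad_eq_eval q (by omega), ← Polynomial.eval_mul,
      Polynomial.eval_eq_sum_range' (natDegree_trunc_mul_trunc_lt p q (by positivity) hk)]
    simp only [coeff_trunc_mul_trunc]
  simp only [h1]
  rw [fft_inverse k w hw]
  change pad n 0 (coeffs (2 ^ k) (ser p * ser q)) = _
  rw [pad_eq_coeffs]
  congr 1
  ext m
  rw [coeff_ser, getD_coeffs]
  split_ifs with h
  · rfl
  · rw [← coeff_trunc_mul_trunc, Polynomial.coeff_eq_zero_of_natDegree_lt]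
    exact (natDegree_trunc_mul_trunc_lt p q (by positivity) hk).trans_le (not_lt.1 h)

/-! ### Logarithms of power series -/

section Log

/-- `L` is the logarithm of the power series `F` with constant term `1`. -/
structure IsLog (F L : PowerSeries ℂ) : Prop where
  constantCoeff_left : PowerSeries.constantCoeff F = 1
  constantCoeff_right : PowerSeries.constantCoeff L = 0
  derivative_mul : PowerSeries.derivative ℂ L * F = PowerSeries.derivative ℂ F

theorem exists_mul_eq_one {F : PowerSeries ℂ} (h : PowerSeries.constantCoeff F = 1) :
    ∃ G, F * G = 1 :=
  ⟨F⁻¹, PowerSeries.mul_inv_cancel F (by simp [h])⟩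

theorem constantCoeff_eq_one_of_mul_eq_one {F G : PowerSeries ℂ}
    (h : PowerSeries.constantCoeff F = 1) (hG : F * G = 1) :
    PowerSeries.constantCoeff G = 1 := by
  simpa [h] using congrArg PowerSeries.constantCoeff hG

theorem exists_isLog {F : PowerSeries ℂ} (h : PowerSeries.constantCoeff F = 1) :
    ∃ L, IsLog F L := by
  obtain ⟨G, hG⟩ := exists_mul_eq_one h
  refine ⟨PowerSeries.mk fun k => PowerSeries.coeff (k - 1) (PowerSeries.derivative ℂ F * G) / k,
    h, by rw [← PowerSeries.coeff_zero_eq_constantCoeff_apply, PowerSeries.coeff_mk]; simp, ?_⟩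
  have h1 : PowerSeries.derivative ℂ (PowerSeries.mk fun k =>
      PowerSeries.coeff (k - 1) (PowerSeries.derivative ℂ F * G) / (k : ℂ)) =
      PowerSeries.derivative ℂ F * G := by
    ext k
    have : (k : ℂ) + 1 ≠ 0 := by exact_mod_cast k.succ_ne_zero
    rw [PowerSeries.coeff_derivative, PowerSeries.coeff_mk]
    push_cast
    field_simp
  rw [h1]
  linear_combination PowerSeries.derivative ℂ F * hG

namespace IsLog

theorem one : IsLog 1 0 := ⟨by simp, by simp, by simp⟩

theorem mul {F G L M : PowerSeries ℂ} (h : IsLog F L) (h' : IsLog G M) :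
    IsLog (F * G) (L + M) := by
  refine ⟨by simp [h.1, h'.1], by simp [h.2, h'.2], ?_⟩
  simp only [map_add, Derivation.leibniz, smul_eq_mul, ← h.3, ← h'.3]
  ring

theorem inv {F G L : PowerSeries ℂ} (h : IsLog F L) (hG : F * G = 1) : IsLog G (-L) := by
  refine ⟨constantCoeff_eq_one_of_mul_eq_one h.1 hG, by simp [h.2], ?_⟩
  have h1 := congrArg (PowerSeries.derivative ℂ) hG
  simp only [Derivation.leibniz, smul_eq_mul, PowerSeries.derivative_one, ← h.3] at h1
  rw [map_neg]
  linear_combination (PowerSeries.derivative ℂ L * G + PowerSeries.derivative ℂ G) * hG - G * h1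

theorem rescale {F L : PowerSeries ℂ} (h : IsLog F L) (b : ℂ) :
    IsLog (PowerSeries.rescale b F) (PowerSeries.rescale b L) := by
  have hd : ∀ G : PowerSeries ℂ, PowerSeries.derivative ℂ (PowerSeries.rescale b G) =
      PowerSeries.C b * PowerSeries.rescale b (PowerSeries.derivative ℂ G) := by
    intro G
    ext k
    simp only [PowerSeries.coeff_derivative, PowerSeries.coeff_rescale, PowerSeries.coeff_C_mul]
    ring
  have hc : ∀ G : PowerSeries ℂ, PowerSeries.constantCoeff (PowerSeries.rescale b G) =
      PowerSeries.constantCoeff G := by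
    intro G
    rw [← PowerSeries.coeff_zero_eq_constantCoeff_apply, PowerSeries.coeff_rescale]
    simp
  refine ⟨by rw [hc, h.1], by rw [hc, h.2], ?_⟩
  rw [hd, hd, ← h.3, map_mul, mul_assoc]

theorem list_prod {α : Type*} (l : List α) (F L : α → PowerSeries ℂ)
    (h : ∀ x ∈ l, IsLog (F x) (L x)) : IsLog (l.map F).prod (l.map L).sum := by
  induction l with
  | nil => exact one
  | cons x l ih =>
    simpa using (h x (by simp)).mul (ih fun y hy => h y (by simp [hy]))

/-- The logarithm of `1 - b s` is `-∑ b^k s^k / k`. -/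
theorem one_sub (b : ℂ) : IsLog (1 - PowerSeries.C b * PowerSeries.X)
    (PowerSeries.mk fun k => -(b ^ k / k)) := by
  refine ⟨by simp, by simp [← PowerSeries.coeff_zero_eq_constantCoeff_apply], ?_⟩
  have h1 : PowerSeries.derivative ℂ (PowerSeries.mk fun k : ℕ => -(b ^ k / (k : ℂ))) =
      PowerSeries.mk fun k => -b ^ (k + 1) := by
    ext k
    have : (k : ℂ) + 1 ≠ 0 := by exact_mod_cast k.succ_ne_zero
    rw [PowerSeries.coeff_derivative, PowerSeries.coeff_mk, PowerSeries.coeff_mk]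
    push_cast
    field_simp
  rw [h1]
  ext k
  rw [mul_sub, mul_one, mul_left_comm, map_sub, PowerSeries.coeff_C_mul]
  cases k with
  | zero =>
    simp
  | succ k =>
    simp [pow_succ]
    ring

end IsLog

theorem X_pow_dvd_derivative {n : ℕ} {F : PowerSeries ℂ} (h : PowerSeries.X ^ (n + 1) ∣ F) :
    PowerSeries.X ^ n ∣ PowerSeries.derivative ℂ F := by
  rw [PowerSeries.X_pow_dvd_iff] at *
  intro k hk
  rw [PowerSeries.coeff_derivative, h _ (by omega), zero_mul]

theorem X_pow_dvd_of_derivative {n : ℕ} {F : PowerSeries ℂ}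
    (h0 : PowerSeries.constantCoeff F = 0)
    (h : PowerSeries.X ^ n ∣ PowerSeries.derivative ℂ F) : PowerSeries.X ^ (n + 1) ∣ F := by
  rw [PowerSeries.X_pow_dvd_iff] at *
  intro k hk
  cases k with
  | zero => simpa using h0
  | succ k =>
    have h1 := h k (by omega)
    rw [PowerSeries.coeff_derivative] at h1
    exact (mul_eq_zero.1 h1).resolve_right (by exact_mod_cast k.succ_ne_zero)

/-- `ln (1 + δ) = δ` up to terms of twice the order of `δ`. -/
theorem IsLog.X_pow_dvd_sub {m : ℕ} (hm : 0 < m) {F L : PowerSeries ℂ} (h : IsLog F L)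
    (hF : PowerSeries.X ^ m ∣ F - 1) : PowerSeries.X ^ (2 * m) ∣ L - (F - 1) := by
  obtain ⟨G, hG⟩ := exists_mul_eq_one h.1
  obtain ⟨m, rfl⟩ : ∃ k, m = k + 1 := ⟨m - 1, by omega⟩
  have h1 := X_pow_dvd_derivative hF
  rw [show 2 * (m + 1) = (m + 1 + m) + 1 by ring]
  apply X_pow_dvd_of_derivative
  · simp [h.1, h.2]
  · simp only [map_sub, PowerSeries.derivative_one, sub_zero] at h1 ⊢
    have h2 : PowerSeries.derivative ℂ L - PowerSeries.derivative ℂ F =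
        -((F - 1) * PowerSeries.derivative ℂ F * G) := by
      linear_combination (1 - (F - 1) * G) * h.3 + (F - 1) * PowerSeries.derivative ℂ L * hG
    rw [h2, dvd_neg, pow_add]
    exact (mul_dvd_mul hF h1).mul_right G

/-- A Newton step for the exponential doubles the precision. -/
theorem IsLog.X_pow_dvd_newton {m : ℕ} (hm : 0 < m) {E H e L : PowerSeries ℂ} (hE : IsLog E H)
    (he : IsLog e L) (h : PowerSeries.X ^ m ∣ e - E) :
    PowerSeries.X ^ (2 * m) ∣ e * (1 + H - L) - E := by
  obtain ⟨J, hJ⟩ := exists_mul_eq_one hE.1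
  have h1 : e * J - 1 = (e - E) * J := by linear_combination hJ
  have h2 := (he.mul (hE.inv hJ)).X_pow_dvd_sub hm (h1 ▸ h.mul_right J)
  have h3 : e * (1 + H - L) - E = -(e * (L + -H - (e * J - 1))) - (e - E) * (e - E) * J := by
    linear_combination (E - 2 * e) * hJ
  rw [h3, two_mul]
  rw [two_mul] at h2
  refine dvd_sub ((dvd_neg).2 (h2.mul_left e)) ?_
  rw [pow_add]
  exact (mul_dvd_mul h h).mul_right J

end Log

/-! ### Correctness of the arithmetic of truncated power series -/

theorem exists_eq_add_of_dvd {n : ℕ} {F G : PowerSeries ℂ} (h : PowerSeries.X ^ n ∣ F - G) :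
    ∃ u, F = G + PowerSeries.X ^ n * u := by
  obtain ⟨u, hu⟩ := h
  exact ⟨u, by linear_combination hu⟩

theorem singleton_pad_eq_coeffs (n : ℕ) (c : ℂ) : pad n 0 [c] = coeffs n (PowerSeries.C c) := by
  rw [pad_eq_coeffs]
  congr 1
  ext k
  rw [coeff_ser, PowerSeries.coeff_C]
  cases k <;> simp

theorem seriesInv_exact {p : List ℂ} {G : PowerSeries ℂ}
    (hp : PowerSeries.constantCoeff (ser p) = 1) (hG : ser p * G = 1) (k : ℕ) :
    (seriesInv exact p k).val = coeffs (2 ^ k) G := by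
  induction k with
  | zero =>
    have := constantCoeff_eq_one_of_mul_eq_one hp hG
    simp [seriesInv, coeffs, this]
  | succ k ih =>
    simp only [seriesInv, bind_val, Arith.natC_val, Arith.exact_nat, Nat.cast_zero,
      seriesMul_exact, zipC_val, Arith.minusC_val, Arith.exact_minus, pad_eq_coeffs, ih]
    rw [← pad_eq_coeffs _ [_], singleton_pad_eq_coeffs, zipWith_sub_coeffs]
    rw [coeffs_eq_iff]
    obtain ⟨u, hu⟩ := exists_ser_coeffs (2 ^ k) G
    obtain ⟨v, hv⟩ := exists_ser_coeffs (2 ^ (k + 1)) (ser p)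
    obtain ⟨w, hw⟩ := exists_ser_coeffs (2 ^ (k + 1)) (PowerSeries.C ((2 : ℕ) : ℂ) -
      ser (coeffs (2 ^ (k + 1)) (ser p)) * ser (coeffs (2 ^ k) G))
    rw [hw, hv, hu, Nat.cast_ofNat, map_ofNat]
    have hY : (PowerSeries.X : PowerSeries ℂ) ^ 2 ^ (k + 1) = PowerSeries.X ^ 2 ^ k *
      PowerSeries.X ^ 2 ^ k := by rw [← pow_add, pow_succ, mul_two]
    rw [hY]
    generalize (PowerSeries.X : PowerSeries ℂ) ^ 2 ^ k = Y
    refine ⟨(G + Y * u) * w - (G + Y * u) * v * (G + Y * u) - ser p * u * u, ?_⟩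
    linear_combination (-(G + 2 * Y * u)) * hG

theorem tail_coeffs (n : ℕ) (F : PowerSeries ℂ) :
    (coeffs (n + 1) F).tail = (List.range n).map fun k => PowerSeries.coeff (k + 1) F := by
  simp [coeffs, List.range_succ_eq_map, Function.comp_def]

theorem seriesLog_exact {n : ℕ} (hn : 0 < n) {p : List ℂ} {F L : PowerSeries ℂ}
    (hp : coeffs n (ser p) = coeffs n F) (h : IsLog F L) : (seriesLog exact n p).val = coeffs n L := by
  obtain ⟨n, rfl⟩ : ∃ m, n = m + 1 := ⟨n - 1, by omega⟩
  obtain ⟨c, hc⟩ := exists_ser_coeffs (n + 1) F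
  have h1 : PowerSeries.constantCoeff (ser (coeffs (n + 1) F)) = 1 := by
    rw [hc]
    simp [h.1]
  obtain ⟨G, hG⟩ := exists_mul_eq_one h1
  simp only [seriesLog, bind_val, pure_val, Arith.natC_val, Arith.exact_nat, Nat.cast_zero,
    seriesMul_exact, zipC_val, Arith.timesC_val, Arith.exact_times, Arith.quotC_val,
    Arith.exact_quot, pad_eq_coeffs _ p, hp, seriesInv_exact h1 hG, tail_coeffs, Nat.add_sub_cancel,
    zipWith_range_map]
  have h2 : ((List.range n).map fun i => ((i + 1 : ℕ) : ℂ) * PowerSeries.coeff (i + 1) F) =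
      coeffs n (PowerSeries.derivative ℂ F) := by
    refine List.map_congr_left fun i _ => ?_
    rw [PowerSeries.coeff_derivative]
    push_cast
    ring
  rw [h2, pad_eq_coeffs _ (coeffs _ G)]
  have h3 : coeffs n (ser (coeffs n (PowerSeries.derivative ℂ F)) *
      ser (coeffs (n + 1) (ser (coeffs (2 ^ Nat.clog 2 (n + 1)) G)))) =
      coeffs n (PowerSeries.derivative ℂ L) := by
    rw [coeffs_eq_iff]
    obtain ⟨u, hu⟩ := exists_ser_coeffs n (PowerSeries.derivative ℂ F)
    obtain ⟨v, hv⟩ := exists_ser_coeffs (n + 1) (ser (coeffs (2 ^ Nat.clog 2 (n + 1)) G))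
    obtain ⟨w, hw⟩ := exists_ser_coeffs (2 ^ Nat.clog 2 (n + 1)) G
    obtain ⟨s, hs⟩ : (PowerSeries.X : PowerSeries ℂ) ^ n ∣
      PowerSeries.X ^ 2 ^ Nat.clog 2 (n + 1) :=
      pow_dvd_pow _ ((Nat.le_succ n).trans (Nat.le_pow_clog (by norm_num) _))
    rw [hu, hv, hw, hs, ← h.3]
    rw [hc] at hG
    refine ⟨(PowerSeries.derivative ℂ L * F) * (s * w + PowerSeries.X * v) +
      u * (G + PowerSeries.X ^ n * s * w + PowerSeries.X ^ (n + 1) * v) -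
      PowerSeries.derivative ℂ L * PowerSeries.X * c * G, ?_⟩
    rw [pow_succ] at *
    linear_combination (PowerSeries.derivative ℂ L) * hG
  rw [h3, coeffs, zipWith_range_map]
  have h4 : (0 : ℂ) :: ((List.range n).map fun i =>
      PowerSeries.coeff i (PowerSeries.derivative ℂ L) / ((i + 1 : ℕ) : ℂ)) = coeffs (n + 1) L := by
    rw [coeffs, List.range_succ_eq_map, List.map_cons, List.map_map]
    congr 1
    · simp [h.2]
    · refine List.map_congr_left fun i _ => ?_
      have : (i : ℂ) + 1 ≠ 0 := by exact_mod_cast i.succ_ne_zero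
      rw [PowerSeries.coeff_derivative]
      push_cast
      simp [this]
  rw [h4, pad_coeffs]

theorem seriesExp_exact {r : ℕ} (hr : 0 < r) {l : List ℂ} {E H : PowerSeries ℂ}
    (hE : IsLog E H) (hl : PowerSeries.X ^ r ∣ ser l - H) (k : ℕ) :
    PowerSeries.X ^ min (2 ^ k) r ∣ ser (seriesExp exact l k).val - E := by
  induction k with
  | zero =>
    rw [pow_zero, min_eq_left (by omega), pow_one, PowerSeries.X_dvd_iff]
    rw [map_sub, hE.1, ← PowerSeries.coeff_zero_eq_constantCoeff_apply, coeff_ser]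
    simp [seriesExp]
  | succ k ih =>
    set e := (seriesExp exact l k).val with he
    have hm : 0 < min (2 ^ k) r := lt_min (by positivity) hr
    have he1 : PowerSeries.constantCoeff (ser e) = 1 := by
      obtain ⟨u, hu⟩ := exists_eq_add_of_dvd ih
      rw [hu, map_add, hE.1, map_mul, map_pow, PowerSeries.constantCoeff_X,
        zero_pow hm.ne', zero_mul, add_zero]
    obtain ⟨L, hL⟩ := exists_isLog he1
    simp only [seriesExp, bind_val, Arith.natC_val, Arith.exact_nat, Nat.cast_zero, ← he,
      seriesMul_exact, zipC_val, Arith.minusC_val, Arith.exact_minus, Arith.plusC_val,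
      Arith.exact_plus, pad_eq_coeffs _ l, seriesLog_exact (Nat.two_pow_pos (k + 1)) rfl hL,
      singleton_pad_eq_coeffs, zipWith_sub_coeffs, zipWith_add_coeffs]
    have h1 := hE.X_pow_dvd_newton hm hL ih
    have hmin : min (2 ^ (k + 1)) r ≤ 2 * min (2 ^ k) r := by rw [pow_succ]; omega
    have h2 := (pow_dvd_pow PowerSeries.X hmin).trans h1
    have hx : (PowerSeries.X : PowerSeries ℂ) ^ min (2 ^ (k + 1)) r ∣
      PowerSeries.X ^ 2 ^ (k + 1) := pow_dvd_pow _ (min_le_left _ _)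
    have hy : (PowerSeries.X : PowerSeries ℂ) ^ min (2 ^ (k + 1)) r ∣ PowerSeries.X ^ r :=
      pow_dvd_pow _ (min_le_right _ _)
    have a1 := hx.trans (X_pow_dvd_ser_coeffs (2 ^ (k + 1)) (ser l))
    have a2 := hy.trans hl
    set c := PowerSeries.C ((1 : ℕ) : ℂ) + (ser l - L) with hcdef
    have hc1 : c = 1 + (ser l - L) := by simp [hcdef]
    have a3 := hx.trans (X_pow_dvd_ser_coeffs (2 ^ (k + 1)) c)
    have a4 := hx.trans (X_pow_dvd_ser_coeffs (2 ^ (k + 1))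
      (ser e * ser (coeffs (2 ^ (k + 1)) c)))
    obtain ⟨u2, h2⟩ := h2
    obtain ⟨u3, h3⟩ := a2
    obtain ⟨u4, h4⟩ := a3
    obtain ⟨u5, h5⟩ := a4
    refine ⟨u2 + ser e * u3 + ser e * u4 + u5, ?_⟩
    linear_combination h2 + ser e * h3 + ser e * h4 + h5 + ser e * hc1

/-! ### Generalized Todd polynomials in exact arithmetic -/

theorem coeff_prod_one_sub_eq_zero (l : List ℂ) (k : ℕ) (hk : l.length < k) :
    PowerSeries.coeff k (l.map fun b => 1 - PowerSeries.C b * PowerSeries.X).prod = 0 := by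
  induction l generalizing k with
  | nil =>
    have : k ≠ 0 := by simp at hk; omega
    simp [PowerSeries.coeff_one, this]
  | cons b l ih =>
    simp only [List.length_cons] at hk
    obtain ⟨k, rfl⟩ : ∃ m, k = m + 1 := ⟨k - 1, by omega⟩
    rw [List.map_cons, List.prod_cons, sub_mul, one_mul, mul_assoc, map_sub,
      PowerSeries.coeff_C_mul, PowerSeries.coeff_succ_X_mul, ih _ (by omega), ih _ (by omega)]
    simp

theorem ser_linearProd_exact (k : ℕ) (l : List ℂ) (hl : l.length ≤ 2 ^ k) :
    ser (linearProd exact k l).val =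
      (l.map fun b => 1 - PowerSeries.C b * PowerSeries.X).prod := by
  induction k generalizing l with
  | zero =>
    match l, hl with
    | [], _ =>
      ext m
      rw [coeff_ser, List.map_nil, List.prod_nil, PowerSeries.coeff_one]
      cases m <;> simp [linearProd]
    | [b], _ =>
      ext m
      rw [coeff_ser]
      rcases m with _ | _ | m <;>
        simp [linearProd, PowerSeries.coeff_one]
  | succ k ih =>
    rw [pow_succ] at hl
    have l1 : (l.take (2 ^ k)).length ≤ 2 ^ k := by simp
    have l2 : (l.drop (2 ^ k)).length ≤ 2 ^ k := by simp; omega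
    have hlen : (l.take (2 ^ k)).length + (l.drop (2 ^ k)).length = l.length := by
      rw [← List.length_append, List.take_append_drop]
    simp only [linearProd, bind_val, seriesMul_exact, ih _ l1, ih _ l2,
      length_linearProd exact k _ l1, length_linearProd exact k _ l2]
    rw [← List.prod_append, ← List.map_append, List.take_append_drop]
    ext m
    rw [coeff_ser, getD_coeffs]
    split_ifs with h
    · rfl
    · rw [coeff_prod_one_sub_eq_zero _ _ (by omega)]

theorem sum_map_neg {α M : Type*} [AddCommGroup M] (l : List α) (F : α → M) :
    (l.map fun x => -F x).sum = -(l.map F).sum := by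
  induction l with
  | nil => simp
  | cons x l ih => simp [ih, add_comm]

theorem coeff_list_sum {α : Type*} (l : List α) (F : α → PowerSeries ℂ) (k : ℕ) :
    PowerSeries.coeff k (l.map F).sum = (l.map fun x => PowerSeries.coeff k (F x)).sum := by
  induction l with
  | nil => simp
  | cons x l ih => simp [ih]

theorem addSimilar_exact {d : ℕ} (hd : 0 < d) (H : PowerSeries ℂ)
    (h0 : PowerSeries.constantCoeff H = 0) (l : List ℂ) :
    (addSimilar exact d (coeffs d H) l).val =
      coeffs d (l.map fun b => PowerSeries.rescale b H).sum := by
  have hfold : ∀ (Bs : List (List ℂ)) (S : PowerSeries ℂ),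
      (foldC (fun acc b => do
        let p ← linearProd exact (Nat.clog 2 b.length) b
        let l ← seriesLog exact d p
        zipC exact.minusC acc l) (coeffs d S) Bs).val =
      coeffs d (S + (Bs.flatten.map fun b : ℂ => PowerSeries.mk fun k : ℕ => b ^ k / (k : ℂ)).sum) := by
    intro Bs
    induction Bs with
    | nil => simp
    | cons b Bs ih =>
      intro S
      have hL : IsLog (ser (linearProd exact (Nat.clog 2 b.length) b).val)
          (b.map fun x : ℂ => PowerSeries.mk fun k : ℕ => -(x ^ k / (k : ℂ))).sum := by
        rw [ser_linearProd_exact _ b (Nat.le_pow_clog (by norm_num) _)]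
        exact IsLog.list_prod _ _ _ fun x _ => IsLog.one_sub x
      have hn : (b.map fun x : ℂ => PowerSeries.mk fun k : ℕ => -(x ^ k / k)).sum =
          -(b.map fun x : ℂ => PowerSeries.mk fun k : ℕ => x ^ k / k).sum := by
        rw [← sum_map_neg]
        rfl
      rw [foldC]
      simp only [bind_val, seriesLog_exact hd rfl hL, zipC_val, Arith.minusC_val, Arith.exact_minus,
        zipWith_sub_coeffs]
      rw [ih, hn, List.flatten_cons, List.map_append, List.sum_append]
      congr 1
      abel
  simp only [addSimilar, bind_val, Arith.natC_val, Arith.exact_nat, Nat.cast_zero]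
  rw [replicate_zero_eq_coeffs, hfold, flatten_blocks d hd, zero_add]
  simp only [zipC_val, bind_val, Arith.natC_val, Arith.exact_nat, Arith.timesC_val,
    Arith.exact_times]
  rw [coeffs, zipWith_range_map, coeffs, zipWith_map_range]
  refine List.map_congr_left fun k _ => ?_
  simp only [coeff_list_sum, PowerSeries.coeff_mk, PowerSeries.coeff_rescale]
  rw [← List.sum_map_mul_left, ← List.sum_map_mul_right]
  congr 1
  refine List.map_congr_left fun b _ => ?_
  rcases k with _ | k
  · simp [h0]
  · have : ((k + 1 : ℕ) : ℂ) ≠ 0 := Nat.cast_ne_zero.2 k.succ_ne_zero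
    field_simp

theorem factorials_exact (n i : ℕ) :
    (factorials exact n i (i.factorial : ℂ)).val =
      (List.range n).map fun k => ((i + k).factorial : ℂ) := by
  induction n generalizing i with
  | zero => rfl
  | succ n ih =>
    have : (i.factorial : ℂ) * ((i + 1 : ℕ) : ℂ) = ((i + 1).factorial : ℂ) := by
      rw [Nat.factorial_succ, mul_comm]
      push_cast
      ring
    simp only [factorials, bind_val, pure_val, Arith.natC_val, Arith.exact_nat, Arith.timesC_val,
      Arith.exact_times, this, ih, List.range_succ_eq_map, List.map_cons, List.map_map]
    congr 1
    refine List.map_congr_left fun k _ => ?_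
    rw [Function.comp_apply, Nat.succ_eq_add_one]
    congr 2
    ring

theorem factorials_exact_zero (n : ℕ) :
    (factorials exact n 0 1).val = (List.range n).map fun k => (k.factorial : ℂ) := by
  simpa using factorials_exact n 0

/-- The power series `(e^s - 1) / s`. -/
noncomputable def toddDen : PowerSeries ℂ :=
  PowerSeries.mk fun k => 1 / ((k + 1).factorial : ℂ)

/-- The power series `1 - y (e^s - 1)`. -/
noncomputable def toddDenY (y : ℂ) : PowerSeries ℂ :=
  1 - PowerSeries.C y * (PowerSeries.exp ℂ - 1)

theorem constantCoeff_toddDen : PowerSeries.constantCoeff toddDen = 1 := by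
  rw [← PowerSeries.coeff_zero_eq_constantCoeff_apply, toddDen, PowerSeries.coeff_mk]
  simp

theorem constantCoeff_toddDenY (y : ℂ) : PowerSeries.constantCoeff (toddDenY y) = 1 := by
  simp [toddDenY]

theorem map_zero_sub_coeffs (d : ℕ) (F : PowerSeries ℂ) :
    ((coeffs d F).map fun x => 0 - x) = coeffs d (-F) := by
  simp [coeffs]

theorem coeffs_ser_coeffs (n : ℕ) (F : PowerSeries ℂ) : coeffs n (ser (coeffs n F)) = coeffs n F :=
  coeffs_eq_iff.2 (X_pow_dvd_ser_coeffs n F)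

theorem lnTodd_exact {d : ℕ} (hd : 0 < d) {T : PowerSeries ℂ} (hT : IsLog toddDen T) :
    (lnTodd exact d).val = coeffs d (-T) := by
  have h1 : (List.range (d + 1)).tail.map (fun k => 1 / (k.factorial : ℂ)) = coeffs d toddDen := by
    rw [List.range_succ_eq_map]
    simp [coeffs, toddDen, Function.comp_def]
  simp only [lnTodd, bind_val, Arith.natC_val, Arith.exact_nat, Nat.cast_zero, Nat.cast_one,
    factorials_exact_zero, mapC_val, Arith.quotC_val, Arith.exact_quot, Arith.minusC_val,
    Arith.exact_minus, ← List.map_tail, List.map_map]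
  have h2 : (List.range (d + 1)).tail.map ((fun x => 1 / x) ∘ fun k => (k.factorial : ℂ)) =
    coeffs d toddDen := h1
  rw [h2, seriesLog_exact hd (coeffs_ser_coeffs d _) hT, map_zero_sub_coeffs]

theorem lnToddY_exact {d : ℕ} (hd : 0 < d) {y : ℂ} {T : PowerSeries ℂ}
    (hT : IsLog (toddDenY y) T) : (lnToddY exact d y).val = coeffs d (-T) := by
  have h1 : 1 :: ((List.range d).map fun k => (k.factorial : ℂ)).tail.map (fun x => 0 - y / x) =
      coeffs d (toddDenY y) := by
    obtain ⟨d, rfl⟩ : ∃ m, d = m + 1 := ⟨d - 1, by omega⟩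
    rw [coeffs, List.range_succ_eq_map]
    simp only [List.map_cons, List.tail_cons, List.map_map]
    congr 1
    · rw [PowerSeries.coeff_zero_eq_constantCoeff_apply, constantCoeff_toddDenY]
    · refine List.map_congr_left fun k _ => ?_
      simp [toddDenY, PowerSeries.coeff_exp, PowerSeries.coeff_one, div_eq_mul_inv]
  simp only [lnToddY, bind_val, Arith.natC_val, Arith.exact_nat, Nat.cast_zero, Nat.cast_one,
    factorials_exact_zero, mapC_val, Arith.quotC_val, Arith.exact_quot, Arith.minusC_val,
    Arith.exact_minus, h1]
  rw [seriesLog_exact hd (coeffs_ser_coeffs d _) hT, map_zero_sub_coeffs]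

theorem gtd_exact {d : ℕ} (hd : 0 < d) (B₀ : List ℂ) (Bs : List (ℂ × List ℂ))
    {G : PowerSeries ℂ}
    (hG : ((B₀.map fun b => PowerSeries.rescale b toddDen).prod *
      (Bs.map fun yB => (yB.2.map fun b => PowerSeries.rescale b (toddDenY yB.1)).prod).prod) *
        G = 1) :
    (gtd exact d B₀ Bs).val = coeffs d G := by
  obtain ⟨T, hT⟩ := exists_isLog constantCoeff_toddDen
  choose U hU using fun y => exists_isLog (constantCoeff_toddDenY y)
  have hlog := ((IsLog.list_prod B₀ _ _ fun b _ => hT.rescale b).mul (IsLog.list_prod Bs _ _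
    fun yB _ => IsLog.list_prod yB.2 _ _ fun b _ => (hU yB.1).rescale b)).inv hG
  have hfold : ∀ (Bs : List (ℂ × List ℂ)) (S : PowerSeries ℂ), (foldC (fun acc yB => do
      let h ← lnToddY exact d yB.1
      let S ← addSimilar exact d h yB.2
      zipC exact.plusC acc S) (coeffs d S) Bs).val = coeffs d (S -
        (Bs.map fun yB => (yB.2.map fun b => PowerSeries.rescale b (U yB.1)).sum).sum) := by
    intro Bs
    induction Bs with
    | nil => simp [foldC]
    | cons yB Bs ih =>
      intro S
      rw [foldC]
      simp only [bind_val, lnToddY_exact hd (hU yB.1)]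
      rw [addSimilar_exact hd _ (by simp [(hU yB.1).2])]
      simp only [zipC_val, Arith.plusC_val, Arith.exact_plus, zipWith_add_coeffs, map_neg,
        sum_map_neg]
      rw [ih, List.map_cons, List.sum_cons]
      congr 1
      abel
  simp only [gtd, bind_val, pure_val, Arith.natC_val, Arith.exact_nat, Nat.cast_zero,
    lnTodd_exact hd hT]
  rw [addSimilar_exact hd _ (by simp [hT.2]), hfold]
  simp only [map_neg, sum_map_neg]
  rw [pad_eq_coeffs, coeffs_eq_iff]
  have h2 := seriesExp_exact hd hlog (l := coeffs d (-(B₀.map fun b =>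
    PowerSeries.rescale b T).sum - (Bs.map fun yB =>
      (yB.2.map fun b => PowerSeries.rescale b (U yB.1)).sum).sum)) (by
      rw [neg_add, ← sub_eq_add_neg]
      exact X_pow_dvd_ser_coeffs _ _) (Nat.clog 2 d)
  rwa [min_eq_right (Nat.le_pow_clog (by norm_num) _)] at h2

/-! ### The algorithm in exact arithmetic -/

theorem getD_map_range {α : Type*} (g : ℕ → α) (n i : ℕ) (z : α) (hi : i < n) :
    ((List.range n).map g).getD i z = g i := by
  rw [List.getD_eq_getElem?_getD]
  simp [hi]

/-- The generating function whose coefficients are the `A_k`, up to inversion, for the root of unity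
`ζ`. -/
noncomputable def waveDen (f : ℕ) (a : List ℕ) (ζ : ℂ) : PowerSeries ℂ :=
  ((a.filter fun x => f ∣ x).map fun x : ℕ => PowerSeries.rescale (x : ℂ) toddDen).prod *
    ((a.filter fun x => ¬ f ∣ x).map fun x : ℕ =>
      PowerSeries.rescale (x : ℂ) (toddDenY (ζ ^ x * (1 / (1 - ζ ^ x))))).prod

/-- `∏_{f ∤ a_i} 1 / (1 - ζ ^ a_i)`. -/
noncomputable def waveRec (f : ℕ) (a : List ℕ) (ζ : ℂ) : ℂ :=
  ((a.filter fun x => ¬ f ∣ x).map fun x => 1 / (1 - ζ ^ x)).prod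

theorem constantCoeff_waveDen (f : ℕ) (a : List ℕ) (ζ : ℂ) :
    PowerSeries.constantCoeff (waveDen f a ζ) = 1 := by
  have h : ∀ (b : ℂ) (F : PowerSeries ℂ), PowerSeries.constantCoeff (PowerSeries.rescale b F) =
      PowerSeries.constantCoeff F := by
    intro b F
    rw [← PowerSeries.coeff_zero_eq_constantCoeff_apply, PowerSeries.coeff_rescale]
    simp
  simp [waveDen, map_list_prod, Function.comp_def, h, constantCoeff_toddDen,
    constantCoeff_toddDenY]

theorem reverse_coeffs (d : ℕ) (F : PowerSeries ℂ) :
    (coeffs d F).reverse = (List.range d).map fun m => PowerSeries.coeff (d - 1 - m) F := by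
  apply List.ext_getElem
  · simp
  · intro i h1 h2
    simp [coeffs]

theorem foldl_mul_eq (l : List ℂ) (s : ℂ) : l.foldl (fun s x => s * x) s = s * l.prod := by
  induction l generalizing s with
  | nil => simp
  | cons x l ih => simp [ih, mul_assoc]

theorem pow_index_eq {η : ℂ} {f : ℕ} (hf : 0 < f) (hη : η ^ f = 1) (i j : ℕ) :
    η ^ ((f - i * j % f) % f) = (η ^ j)⁻¹ ^ i := by
  have h1 : η ^ ((f - i * j % f) % f) = η ^ (f - i * j % f) := (pow_eq_pow_mod _ hη).symm
  have h2 : η ^ (i * j % f) = η ^ (i * j) := (pow_eq_pow_mod _ hη).symm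
  have h3 : η ^ (f - i * j % f) * η ^ (i * j % f) = 1 := by
    rw [← pow_add, Nat.sub_add_cancel (Nat.mod_lt _ hf).le, hη]
  rw [h1, inv_pow, ← pow_mul, mul_comm j i, ← h2]
  exact eq_inv_of_mul_eq_one_left h3

theorem waveRound_exact {f : ℕ} (hf : 0 < f) {a : List ℕ} (hd : 0 < numDiv f a) {η : ℂ}
    (hη : η ^ f = 1) {pw rec ys : List ℂ}
    (hpw : ∀ c, c < f → pw.getD c 0 = η ^ c)
    (hrec : ∀ c, 0 < c → c < f → rec.getD c 0 = 1 / (1 - η ^ c))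
    (hys : ∀ c, 0 < c → c < f → ys.getD c 0 = η ^ c * (1 / (1 - η ^ c)))
    {j : ℕ} (hj : j.Coprime f) :
    (waveRound exact f a pw rec ys ((a.filter fun x => f ∣ x).map fun x : ℕ => (x : ℂ))
      ((List.range' 1 (f - 1)).map fun c => (a.filter fun x => x % f = c).map fun x : ℕ => (x : ℂ))
      j).val = (List.range' 1 f).map fun i => (List.range (numDiv f a)).map fun m =>
        (η ^ j)⁻¹ ^ i * (PowerSeries.coeff (numDiv f a - 1 - m) (waveDen f a (η ^ j))⁻¹ *
          waveRec f a (η ^ j)) := by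
  have hmod : ∀ x, η ^ (j * x % f) = (η ^ j) ^ x := by
    intro x
    rw [← pow_mul]
    exact (pow_eq_pow_mod _ hη).symm
  have hpos : ∀ x, ¬ f ∣ x → 0 < j * x % f := by
    intro x hx
    rw [Nat.pos_iff_ne_zero]
    intro h0
    exact hx (hj.symm.dvd_of_dvd_mul_left (Nat.dvd_of_mod_eq_zero h0))
  have hG := PowerSeries.mul_inv_cancel (waveDen f a (η ^ j))
    (by simp [constantCoeff_waveDen])
  have hlen : ((a.filter fun x => f ∣ x).map fun x : ℕ => (x : ℂ)).length = numDiv f a := by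
    rw [List.length_map, length_filter_dvd]
  have hD : (foldC exact.timesC 1 ((a.filter fun x => ¬ f ∣ x).map fun x : ℕ =>
      rec.getD (j * x % f) 0)).val = waveRec f a (η ^ j) := by
    simp only [foldC_val, Arith.timesC_val, Arith.exact_times, foldl_mul_eq, one_mul, waveRec]
    congr 1
    refine List.map_congr_left fun x hx => ?_
    have hx : ¬ f ∣ x := by simpa using (List.mem_filter.1 hx).2
    rw [hrec _ (hpos x hx) (Nat.mod_lt _ hf), hmod]
  have hgtd : (gtd exact (numDiv f a) ((a.filter fun x => f ∣ x).map fun x : ℕ => (x : ℂ))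
      (((List.range' 1 (f - 1)).map fun c => ys.getD (j * c % f) 0).zip
        ((List.range' 1 (f - 1)).map fun c =>
          (a.filter fun x => x % f = c).map fun x : ℕ => (x : ℂ)))).val =
      coeffs (numDiv f a) (waveDen f a (η ^ j))⁻¹ := by
    refine gtd_exact hd _ _ ?_
    rw [← hG]
    congr 1
    rw [waveDen, ← prod_map_filter_mod _ f hf a, List.map_map, List.zip_map', List.map_map]
    congr 2
    refine List.map_congr_left fun c hc => ?_
    simp only [Function.comp_apply, List.map_map]
    congr 1
    refine List.map_congr_left fun x hx => ?_
    have hx : x % f = c := by simpa using (List.mem_filter.1 hx).2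
    have hc : 0 < c := by
      have := List.mem_range'_1.1 hc
      omega
    have hxf : ¬ f ∣ x := fun h => by
      rw [Nat.mod_eq_zero_of_dvd h] at hx
      omega
    have h2 : j * c % f = j * x % f := by rw [← hx]; simp [Nat.mul_mod]
    rw [Function.comp_apply, h2, hys _ (hpos x hxf) (Nat.mod_lt _ hf), hmod]
  simp only [waveRound, bind_val, Arith.natC_val, Arith.exact_nat, Nat.cast_zero, Nat.cast_one,
    hlen, hgtd, hD, mapC_val, Arith.timesC_val, Arith.exact_times, reverse_coeffs, List.map_map]
  refine List.map_congr_left fun i _ => ?_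
  rw [hpw _ (Nat.mod_lt _ hf), pow_index_eq hf hη]
  rfl

theorem foldl_zipWith_add (f d : ℕ) (J : List ℕ) (v : ℕ → ℕ → ℕ → ℂ) (s : ℕ → ℕ → ℂ) :
    (J.map fun j => (List.range' 1 f).map fun i => (List.range d).map fun m => v j i m).foldl
      (fun S V => List.zipWith (fun r r' => List.zipWith (fun x y => x + y) r r') S V)
      ((List.range' 1 f).map fun i => (List.range d).map fun m => s i m) =
    (List.range' 1 f).map fun i => (List.range d).map fun m =>
      s i m + (J.map fun j => v j i m).sum := by
  induction J generalizing s with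
  | nil => simp
  | cons j J ih =>
    rw [List.map_cons, List.foldl_cons, List.zipWith_map, List.zipWith_self]
    simp only [zipWith_map_range]
    rw [ih]
    simp [add_assoc]

theorem sum_unitResidues {f : ℕ} (hf : 0 < f) (g : ℂ → ℂ) :
    ((unitResidues f).map fun j => g (exact.root f ^ j)).sum = ∑ ζ ∈ primitiveRoots f ℂ, g ζ := by
  have hη := isPrimitiveRoot_exact_root f hf
  have hnd : (unitResidues f).Nodup := List.Nodup.filter _ List.nodup_range'
  have hmem : ∀ j, j ∈ unitResidues f ↔ (1 ≤ j ∧ j < 1 + f) ∧ j.Coprime f := by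
    intro j
    simp only [unitResidues, List.mem_filter, List.mem_range'_1, decide_eq_true_eq]
  rw [← List.sum_toFinset _ hnd]
  refine Finset.sum_bij (fun j _ => exact.root f ^ j) ?_ ?_ ?_ fun _ _ => rfl
  · intro j hj
    rw [List.mem_toFinset, hmem] at hj
    exact (mem_primitiveRoots hf).2 (hη.pow_of_coprime j hj.2)
  · intro i hi j hj h
    rw [List.mem_toFinset, hmem] at hi hj
    obtain ⟨i, rfl⟩ : ∃ m, i = m + 1 := ⟨i - 1, by omega⟩
    obtain ⟨j, rfl⟩ : ∃ m, j = m + 1 := ⟨j - 1, by omega⟩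
    rw [pow_succ, pow_succ, mul_left_inj' (hη.ne_zero hf.ne')] at h
    rw [hη.pow_inj (by omega) (by omega) h]
  · intro ζ hζ
    have : NeZero f := ⟨hf.ne'⟩
    obtain ⟨i, hi, hc, rfl⟩ := hη.isPrimitiveRoot_iff.1 ((mem_primitiveRoots hf).1 hζ)
    rcases Nat.eq_zero_or_pos i with rfl | h0
    · refine ⟨f, ?_, by rw [hη.pow_eq_one, pow_zero]⟩
      rw [Nat.coprime_zero_left] at hc
      subst hc
      rw [List.mem_toFinset, hmem]
      simp
    · refine ⟨i, ?_, rfl⟩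
      rw [List.mem_toFinset, hmem]
      exact ⟨by omega, hc⟩

/-- The coefficient of `t^m` in `P_i`. -/
noncomputable def waveCoeff (f : ℕ) (a : List ℕ) (i m : ℕ) : ℂ :=
  (-1) ^ (numDiv f a + m + 1) * (∑ ζ ∈ primitiveRoots f ℂ, ζ⁻¹ ^ i *
    (PowerSeries.coeff (numDiv f a - 1 - m) (waveDen f a ζ)⁻¹ * waveRec f a ζ)) /
      (m.factorial * ((a.filter fun x => f ∣ x).map fun x : ℕ => (x : ℂ)).prod)

theorem floatWave_exact {f : ℕ} (hf : 0 < f) {a : List ℕ} (hd : 0 < numDiv f a) :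
    (floatWave exact f a).val = (List.range f).map fun i => (List.range (numDiv f a)).map fun m =>
      waveCoeff f a (i + 1) m := by
  have hη := isPrimitiveRoot_exact_root f hf
  have hlen : ((a.filter fun x => f ∣ x).map fun x : ℕ => (x : ℂ)).length = numDiv f a := by
    rw [List.length_map, length_filter_dvd]
  have hV : ∀ j ∈ unitResidues f, _ := fun j hj =>
    waveRound_exact (j := j) hf hd hη.pow_eq_one
      (pw := (List.range f).map fun i => exact.root f ^ i)
      (rec := 0 :: (List.range (f - 1)).map fun i => 1 / (1 - exact.root f ^ (i + 1)))
      (ys := 0 :: (List.range (f - 1)).map fun i =>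
        exact.root f ^ (i + 1) * (1 / (1 - exact.root f ^ (i + 1))))
      (fun c hc => getD_map_range _ _ _ _ hc)
      (fun c hc hcf => by
        obtain ⟨c, rfl⟩ : ∃ m, c = m + 1 := ⟨c - 1, by omega⟩
        rw [List.getD_cons_succ, getD_map_range _ _ _ _ (by omega)])
      (fun c hc hcf => by
        obtain ⟨c, rfl⟩ : ∃ m, c = m + 1 := ⟨c - 1, by omega⟩
        rw [List.getD_cons_succ, getD_map_range _ _ _ _ (by omega)])
      (by simpa [unitResidues] using (List.mem_filter.1 hj).2)
  have htail : ((List.range f).map fun i => exact.root f ^ i).tail =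
      (List.range (f - 1)).map fun i => exact.root f ^ (i + 1) := by
    obtain ⟨f, rfl⟩ : ∃ m, f = m + 1 := ⟨f - 1, by omega⟩
    simp [List.range_succ_eq_map, Function.comp_def]
  have hrep : List.replicate f (List.replicate (numDiv f a) (0 : ℂ)) =
      (List.range' 1 f).map fun i => (List.range (numDiv f a)).map fun m => 0 := by
    simp [List.map_const']
  simp only [floatWave, bind_val, Arith.natC_val, Arith.exact_nat, Nat.cast_zero, Nat.cast_one,
    mapC_val, hlen, foldC_val, Arith.timesC_val, Arith.exact_times, foldl_mul_eq, one_mul,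
    factorials_exact_zero, Arith.rootC_val, geom_exact, htail, List.map_map, zipC_val,
    Arith.minusC_val, Arith.exact_minus, Arith.quotC_val, Arith.exact_quot, Arith.plusC_val,
    Arith.exact_plus]
  simp only [zipWith_map_range, Function.comp_def]
  rw [List.map_congr_left hV, hrep, foldl_zipWith_add, List.range'_eq_map_range, List.map_map,
    List.map_map]
  refine List.map_congr_left fun i _ => ?_
  simp only [Function.comp_apply, zipWith_range_map, zero_add]
  refine List.map_congr_left fun m hm => ?_
  rw [getD_map_range _ _ _ _ (List.mem_range.1 hm), waveCoeff, add_comm 1 i,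
    sum_unitResidues hf fun ζ => ζ⁻¹ ^ (i + 1) *
      (PowerSeries.coeff (numDiv f a - 1 - m) (waveDen f a ζ)⁻¹ * waveRec f a ζ)]
  split_ifs with h
  · rw [(Nat.even_iff.2 h).neg_one_pow, one_mul, pure_val]
  · rw [(Nat.not_even_iff_odd.1 fun h' => h (Nat.even_iff.1 h')).neg_one_pow, Arith.minusC_val,
      Arith.exact_minus]
    ring

/-! ### The Sylvester wave as a quasi-polynomial -/

theorem one_sub_rescale_exp (x : ℂ) :
    1 - PowerSeries.rescale x (PowerSeries.exp ℂ) =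
      PowerSeries.C (-x) * PowerSeries.X * PowerSeries.rescale x toddDen := by
  ext k
  rw [mul_assoc, PowerSeries.coeff_C_mul]
  rcases k with _ | k
  · rw [PowerSeries.coeff_zero_X_mul, map_sub, PowerSeries.coeff_rescale, PowerSeries.coeff_exp]
    simp
  · rw [PowerSeries.coeff_succ_X_mul]
    simp [PowerSeries.coeff_one, PowerSeries.coeff_rescale, toddDen, PowerSeries.coeff_exp,
      pow_succ]
    ring

theorem one_sub_mul_rescale_exp (x : ℂ) {z : ℂ} (hz : z ≠ 1) :
    1 - PowerSeries.C z * PowerSeries.rescale x (PowerSeries.exp ℂ) =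
      PowerSeries.C (1 - z) * PowerSeries.rescale x (toddDenY (z * (1 / (1 - z)))) := by
  have hz' : 1 - z ≠ 0 := sub_ne_zero.2 hz.symm
  have h : PowerSeries.rescale x (PowerSeries.C (z * (1 / (1 - z)))) =
      PowerSeries.C (z * (1 / (1 - z))) := by
    ext k
    rw [PowerSeries.coeff_rescale, PowerSeries.coeff_C]
    split_ifs with hk <;> simp [hk]
  have h2 : PowerSeries.C (1 - z) * PowerSeries.C (z * (1 / (1 - z))) = PowerSeries.C z := by
    rw [← map_mul]
    congr 1
    field_simp
  rw [toddDenY, map_sub (PowerSeries.rescale x), map_mul (PowerSeries.rescale x), h, mul_sub,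
    ← mul_assoc, h2, map_sub (PowerSeries.rescale x), map_one (PowerSeries.rescale x), map_sub,
    map_one]
  ring

theorem prod_one_sub_eq {f : ℕ} {ζ : ℂ} (hζ : IsPrimitiveRoot ζ f) (a : List ℕ) :
    (a.map fun x : ℕ => 1 - PowerSeries.C (ζ ^ x) *
      PowerSeries.rescale (x : ℂ) (PowerSeries.exp ℂ)).prod =
    PowerSeries.C ((-1) ^ numDiv f a * ((a.filter fun x => f ∣ x).map fun x : ℕ => (x : ℂ)).prod *
      (waveRec f a ζ)⁻¹) * PowerSeries.X ^ numDiv f a * waveDen f a ζ := by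
  induction a with
  | nil => simp [numDiv, waveRec, waveDen]
  | cons x a ih =>
    rw [List.map_cons, List.prod_cons, ih]
    by_cases h : f ∣ x
    · rw [(hζ.pow_eq_one_iff_dvd x).2 h, map_one, one_mul, one_sub_rescale_exp]
      simp [numDiv, waveRec, waveDen, h, pow_succ]
      ring
    · rw [one_sub_mul_rescale_exp _ fun h1 => h ((hζ.pow_eq_one_iff_dvd x).1 h1)]
      simp [numDiv, waveRec, waveDen, h]
      ring

theorem waveRec_ne_zero {f : ℕ} {ζ : ℂ} (hζ : IsPrimitiveRoot ζ f) (a : List ℕ) :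
    waveRec f a ζ ≠ 0 := by
  refine List.prod_ne_zero fun h => ?_
  obtain ⟨x, hx, h0⟩ := List.mem_map.1 h
  have hx : ¬ f ∣ x := by simpa using (List.mem_filter.1 hx).2
  rw [one_div, inv_eq_zero, sub_eq_zero] at h0
  exact hx ((hζ.pow_eq_one_iff_dvd x).1 h0.symm)

theorem prod_filter_dvd_ne_zero (f : ℕ) {a : List ℕ} (ha : ∀ x ∈ a, 0 < x) :
    ((a.filter fun x => f ∣ x).map fun x : ℕ => (x : ℂ)).prod ≠ 0 := by
  refine List.prod_ne_zero fun h => ?_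
  obtain ⟨x, hx, h0⟩ := List.mem_map.1 h
  exact (ha x (List.mem_of_mem_filter hx)).ne' (Nat.cast_eq_zero.1 h0)

theorem coeff_laurent_quotient {d : ℕ} (hd : 0 < d) {c : ℂ} (hc : c ≠ 0) (N D : PowerSeries ℂ)
    (hD : PowerSeries.constantCoeff D = 1) :
    ((N : LaurentSeries ℂ) / ((PowerSeries.C c * PowerSeries.X ^ d * D : PowerSeries ℂ) :
      LaurentSeries ℂ)).coeff (-1) = c⁻¹ * PowerSeries.coeff (d - 1) (N * D⁻¹) := by
  have h1 : (N : LaurentSeries ℂ) / ((PowerSeries.C c * PowerSeries.X ^ d * D : PowerSeries ℂ) :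
      LaurentSeries ℂ) = ((PowerSeries.C c⁻¹ * (N * D⁻¹) : PowerSeries ℂ) : LaurentSeries ℂ) *
        HahnSeries.single (-(d : ℤ)) 1 := by
    have hD' : D⁻¹ * D = 1 := PowerSeries.inv_mul_cancel D (by simp [hD])
    have hX : HahnSeries.single (-(d : ℤ)) (1 : ℂ) *
        ((PowerSeries.X ^ d : PowerSeries ℂ) : LaurentSeries ℂ) = 1 := by
      rw [HahnSeries.ofPowerSeries_X_pow, HahnSeries.single_mul_single]
      simp
    have hC : PowerSeries.C c⁻¹ * PowerSeries.C c = 1 := by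
      rw [← map_mul, inv_mul_cancel₀ hc, map_one]
    have hQ : ((PowerSeries.C c⁻¹ * (N * D⁻¹) : PowerSeries ℂ) : LaurentSeries ℂ) *
        HahnSeries.single (-(d : ℤ)) 1 * ((PowerSeries.C c * PowerSeries.X ^ d * D :
          PowerSeries ℂ) : LaurentSeries ℂ) = (N : LaurentSeries ℂ) := by
      calc _ = ((PowerSeries.C c⁻¹ * (N * D⁻¹) * (PowerSeries.C c * D) : PowerSeries ℂ) :
            LaurentSeries ℂ) * (HahnSeries.single (-(d : ℤ)) 1 *
              ((PowerSeries.X ^ d : PowerSeries ℂ) : LaurentSeries ℂ)) := by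
            simp only [PowerSeries.coe_mul]
            ring
        _ = (N : LaurentSeries ℂ) := by
            rw [hX, mul_one]
            congr 1
            linear_combination (N * D⁻¹ * D) * hC + N * hD'
    rw [div_eq_iff, hQ]
    have hne : PowerSeries.C c * PowerSeries.X ^ d * D ≠ 0 := by
      refine mul_ne_zero (mul_ne_zero ?_ (pow_ne_zero _ PowerSeries.X_ne_zero)) fun h => ?_
      · simpa using hc
      · simp [h] at hD
    exact (map_ne_zero_iff _ HahnSeries.ofPowerSeries_injective).2 hne
  rw [h1, show (-1 : ℤ) = ((d - 1 : ℕ) : ℤ) + -(d : ℤ) by omega, HahnSeries.coeff_mul_single_add,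
    mul_one, LaurentSeries.coeff_coe_powerSeries, PowerSeries.coeff_C_mul]

theorem coeff_exp_mul {d : ℕ} (hd : 0 < d) (c : ℂ) (F : PowerSeries ℂ) :
    PowerSeries.coeff (d - 1) (PowerSeries.rescale c (PowerSeries.exp ℂ) * F) =
      ∑ m ∈ Finset.range d, c ^ m / m.factorial * PowerSeries.coeff (d - 1 - m) F := by
  obtain ⟨d, rfl⟩ : ∃ m, d = m + 1 := ⟨d - 1, by omega⟩
  rw [Nat.add_sub_cancel, PowerSeries.coeff_mul, Finset.Nat.sum_antidiagonal_eq_sum_range_succ_mk]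
  simp [PowerSeries.coeff_rescale, PowerSeries.coeff_exp, div_eq_mul_inv]

theorem map_coe_list {M : Type} (F : ℂ → M) (a : List ℕ) :
    (a.map fun x => F x) = List.map (fun x : ℕ => F (x : ℂ)) a := by
  induction a with
  | nil => rfl
  | cons x a ih => simpa using ih

/-- The polynomial `P_i`. -/
noncomputable def wavePoly (f : ℕ) (a : List ℕ) (i : ℕ) : ℂ[X] :=
  ∑ m ∈ Finset.range (numDiv f a), Polynomial.monomial m (waveCoeff f a i m)

theorem coeff_wavePoly {f : ℕ} {a : List ℕ} {m : ℕ} (hm : m < numDiv f a) (i : ℕ) :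
    (wavePoly f a i).coeff m = waveCoeff f a i m := by
  simp [wavePoly, Polynomial.coeff_monomial, hm]

theorem degree_wavePoly_lt (f : ℕ) (a : List ℕ) (i : ℕ) :
    (wavePoly f a i).degree < numDiv f a := by
  rw [Polynomial.degree_lt_iff_coeff_zero]
  intro m hm
  simp only [wavePoly, Polynomial.finsetSum_coeff, Polynomial.coeff_monomial]
  refine Finset.sum_eq_zero fun k hk => if_neg ?_
  have := Finset.mem_range.1 hk
  omega

theorem eval_wavePoly (f : ℕ) (a : List ℕ) (i : ℕ) (t : ℂ) :
    (wavePoly f a i).eval t = ∑ m ∈ Finset.range (numDiv f a), waveCoeff f a i m * t ^ m := by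
  simp [wavePoly, Polynomial.eval_finsetSum]

theorem isQuasiPoly_sylvesterWave {f : ℕ} (hf : 0 < f) {a : List ℕ} (ha : ∀ x ∈ a, 0 < x)
    (hd : 0 < numDiv f a) : IsQuasiPoly f (sylvesterWave f a) (wavePoly f a) := by
  intro t i _ _ hti
  have hmain : ∀ ζ ∈ primitiveRoots f ℂ, (HahnSeries.C (ζ⁻¹ ^ t) * expSeries (-(t : ℂ)) /
        (a.map fun x => 1 - HahnSeries.C (ζ ^ x) * expSeries (x : ℂ)).prod).coeff (-1) =
      ∑ m ∈ Finset.range (numDiv f a), (-1) ^ (numDiv f a + m) * (ζ⁻¹ ^ i *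
        (PowerSeries.coeff (numDiv f a - 1 - m) (waveDen f a ζ)⁻¹ * waveRec f a ζ)) /
      (m.factorial * ((a.filter fun x => f ∣ x).map fun x : ℕ => (x : ℂ)).prod) * (t : ℂ) ^ m := by
    intro ζ hζ
    have hζ := (mem_primitiveRoots hf).1 hζ
    have hden : (a.map fun x => 1 - HahnSeries.C (ζ ^ x) * expSeries (x : ℂ)).prod =
        (((a.map fun x : ℕ => 1 - PowerSeries.C (ζ ^ x) *
          PowerSeries.rescale (x : ℂ) (PowerSeries.exp ℂ)).prod : PowerSeries ℂ) :
            LaurentSeries ℂ) := by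
      rw [map_list_prod, List.map_map,
        map_coe_list fun x => 1 - HahnSeries.C (ζ ^ x) * expSeries x]
      congr 1
      refine List.map_congr_left fun x _ => ?_
      simp [expSeries]
    have hnum : HahnSeries.C (ζ⁻¹ ^ t) * expSeries (-(t : ℂ)) = ((PowerSeries.C (ζ⁻¹ ^ t) *
        PowerSeries.rescale (-(t : ℂ)) (PowerSeries.exp ℂ) : PowerSeries ℂ) :
          LaurentSeries ℂ) := by
      simp [expSeries]
    have hP := prod_filter_dvd_ne_zero f ha
    have hR := waveRec_ne_zero hζ a
    have hpow : ζ⁻¹ ^ t = ζ⁻¹ ^ i := by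
      have h1 : ζ⁻¹ ^ f = 1 := hζ.inv.pow_eq_one
      rw [pow_eq_pow_mod t h1, pow_eq_pow_mod i h1, hti]
    rw [hden, hnum, prod_one_sub_eq hζ, coeff_laurent_quotient hd
      (mul_ne_zero (mul_ne_zero (pow_ne_zero _ (by norm_num)) hP) (inv_ne_zero hR)) _ _
      (constantCoeff_waveDen f a ζ), mul_assoc (PowerSeries.C _), PowerSeries.coeff_C_mul,
      coeff_exp_mul hd, Finset.mul_sum, Finset.mul_sum, hpow]
    refine Finset.sum_congr rfl fun m _ => ?_
    have h1 : ((-1 : ℂ) ^ numDiv f a)⁻¹ = (-1) ^ numDiv f a := by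
      rw [← inv_pow]
      norm_num
    rw [mul_inv, mul_inv, inv_inv, h1, neg_pow (t : ℂ) m, pow_add]
    field_simp
  rw [sylvesterWave, HahnSeries.coeff_sum, Finset.sum_congr rfl hmain, Finset.sum_comm,
    eval_wavePoly, ← Finset.sum_neg_distrib]
  refine Finset.sum_congr rfl fun m _ => ?_
  rw [waveCoeff, ← Finset.sum_mul, ← Finset.sum_div, ← Finset.mul_sum, pow_succ]
  ring

theorem coeffTable_wavePoly {f : ℕ} (hf : 0 < f) {a : List ℕ} (hd : 0 < numDiv f a) :
    (floatWave exact f a).val = coeffTable f (numDiv f a) (wavePoly f a) := by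
  rw [floatWave_exact hf hd, coeffTable]
  refine List.map_congr_left fun i _ => List.map_congr_left fun m hm => ?_
  rw [coeff_wavePoly (List.mem_range.1 hm)]

/-! ### Numerical stability -/

section Stability

open Filter Topology

/-- Pairs of a unit roundoff and an arithmetic that has it. -/
def RoundedArith : Type := {p : ℝ × Arith ℂ // p.2.HasRoundoff p.1}

/-- All rounded arithmetics at once: a number is a family of complex numbers. -/
def Arith.family : Arith (RoundedArith → ℂ) where
  nat n p := p.1.2.nat n
  root n p := p.1.2.root n
  plus x y p := p.1.2.plus (x p) (y p)
  minus x y p := p.1.2.minus (x p) (y p)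
  times x y p := p.1.2.times (x p) (y p)
  quot x y p := p.1.2.quot (x p) (y p)

theorem Arith.sim_family_eval (p : RoundedArith) :
    Arith.Sim Arith.family p.1.2 (fun x y => x p = y) fun _ => True where
  nat _ := rfl
  root _ _ := rfl
  plus := by rintro x _ y _ rfl rfl; rfl
  minus := by rintro x _ y _ rfl rfl; rfl
  times := by rintro x _ y _ rfl rfl; rfl
  quot := by rintro x _ y _ rfl rfl _; rfl
  ok_nat _ _ := trivial
  ok_root _ _ := trivial
  ok_times _ _ := trivial

/-- The filter of rounded arithmetics whose unit roundoff tends to `0`. -/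
def smallRoundoff : Filter RoundedArith := comap (fun p => p.1.1) (𝓝[>] 0)

theorem tendsto_roundoff : Tendsto (fun p : RoundedArith => p.1.1) smallRoundoff (𝓝 0) :=
  tendsto_comap.mono_right nhdsWithin_le_nhds

theorem tendsto_of_relative_error {w z : RoundedArith → ℂ} {c : ℂ}
    (hz : Tendsto z smallRoundoff (𝓝 c))
    (h : ∀ᶠ p in smallRoundoff, ‖w p - z p‖ ≤ p.1.1 * ‖z p‖) :
    Tendsto w smallRoundoff (𝓝 c) := by
  have h1 : Tendsto (fun p => w p - z p) smallRoundoff (𝓝 0) := by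
    refine squeeze_zero_norm' h ?_
    simpa using tendsto_roundoff.mul hz.norm
  simpa using h1.add hz

theorem Arith.sim_family_exact : Arith.Sim Arith.family exact
    (fun x y => Tendsto x smallRoundoff (𝓝 y)) (fun y => y ≠ 0) where
  nat n := tendsto_of_relative_error tendsto_const_nhds (.of_forall fun p => p.2.nat n)
  root n hn := by
    refine tendsto_of_relative_error (z := fun _ => exact.root n) tendsto_const_nhds
      (.of_forall fun p => ?_)
    rw [(isPrimitiveRoot_exact_root n hn).norm'_eq_one hn.ne', mul_one]
    exact p.2.root n hn
  plus hx hy := tendsto_of_relative_error (hx.add hy) (.of_forall fun p => p.2.plus _ _)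
  minus hx hy := tendsto_of_relative_error (hx.sub hy) (.of_forall fun p => p.2.minus _ _)
  times hx hy := tendsto_of_relative_error (hx.mul hy) (.of_forall fun p => p.2.times _ _)
  quot hx hy h0 := tendsto_of_relative_error (hx.div hy h0)
    ((hy.eventually_ne h0).mono fun p hp => p.2.quot _ _ hp)
  ok_nat n hn := by simpa using hn.ne'
  ok_root n _ := Complex.exp_ne_zero _
  ok_times hx hy := mul_ne_zero hx hy

theorem forall₂_comp {α β γ : Type*} {R : α → β → Prop} {S : α → γ → Prop} {T : β → γ → Prop}
    {l : List α} {m : List β} {n : List γ} (hR : Forall₂ R l m) (hS : Forall₂ S l n)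
    (h : ∀ x y z, R x y → S x z → T y z) : Forall₂ T m n := by
  induction hR generalizing n with
  | nil => cases hS; exact .nil
  | cons h1 _ ih => cases hS with | cons h2 h3 => exact .cons (h _ _ _ h1 h2) (ih h3)

theorem eventually_forall₂ {ι α β : Type*} {F : Filter ι} {R : ι → α → β → Prop} {l : List α}
    {m : List β} (h : Forall₂ (fun x y => ∀ᶠ p in F, R p x y) l m) :
    ∀ᶠ p in F, Forall₂ (R p) l m := by
  induction h with
  | nil => exact .of_forall fun _ => .nil
  | cons h1 _ ih =>
    filter_upwards [h1, ih] with p hp hp'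
    exact .cons hp hp'

theorem exists_roundoff_of_eventually {S : RoundedArith → Prop}
    (h : ∀ᶠ p in smallRoundoff, S p) :
    ∃ u : ℝ, 0 < u ∧ ∀ (A : Arith ℂ) (hA : A.HasRoundoff u), S ⟨(u, A), hA⟩ := by
  rw [smallRoundoff, eventually_comap] at h
  obtain ⟨u, hu, hu0⟩ := (h.and self_mem_nhdsWithin).exists
  exact ⟨u, hu0, fun A hA => hu _ rfl⟩

theorem exists_roundoff_floatWave {f : ℕ} (hf : 0 < f) {a : List ℕ} (ha : ∀ x ∈ a, 0 < x)
    {ε : ℝ} (hε : 0 < ε) : ∃ u : ℝ, 0 < u ∧ ∀ A : Arith ℂ, A.HasRoundoff u →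
      Forall₂ (Forall₂ fun x y => ‖x - y‖ < ε) (floatWave A f a).val (floatWave exact f a).val := by
  have hη := isPrimitiveRoot_exact_root f hf
  have h1 := Arith.sim_family_exact.floatWave hf ha (by
    intro y hy
    rw [Arith.exact_nat, Nat.cast_one, geom_exact, ← map_tail] at hy
    obtain ⟨i, hi, rfl⟩ := mem_map.1 hy
    have hi' : 0 < i ∧ i < f := by
      obtain ⟨f, rfl⟩ : ∃ m, f = m + 1 := ⟨f - 1, by omega⟩
      rw [range_succ_eq_map, tail_cons] at hi
      simp at hi
      omega
    rw [Arith.exact_nat, Nat.cast_one, one_mul, Arith.exact_minus, sub_ne_zero]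
    exact (hη.pow_ne_one_of_pos_of_lt hi'.1.ne' hi'.2).symm)
  have h2 := eventually_forall₂ (F := smallRoundoff)
    (R := fun p => Forall₂ fun (x : RoundedArith → ℂ) y => ‖x p - y‖ < ε)
    (h1.imp fun X Y hXY => eventually_forall₂ (hXY.imp fun x y hxy => by
      simpa [dist_eq_norm] using (Metric.tendsto_nhds.1 hxy) ε hε))
  obtain ⟨u, hu, hS⟩ := exists_roundoff_of_eventually h2
  refine ⟨u, hu, fun A hA => ?_⟩
  have h3 := (Arith.sim_family_eval ⟨(u, A), hA⟩).floatWave hf ha fun _ _ => trivial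
  exact forall₂_comp h3 (hS A hA) fun X Y Z hXY hXZ => forall₂_comp hXY hXZ
    fun x y z hxy hxz => hxy ▸ hxz

end Stability

end FloatDenum

theorem mainTheorem4 :
    (∃ C : ℝ, ∀ (a : List ℕ) (f : ℕ),
      (∀ x ∈ a, 0 < x) → (a : Multiset ℕ).gcd = 1 → (∃ x ∈ a, f ∣ x) →
      (∀ A : FloatDenum.Arith ℂ,
        ((FloatDenum.floatWave A f a).ops : ℝ) ≤
          C * (((f : ℝ) * FloatDenum.numDiv f a * Real.log (FloatDenum.numDiv f a + 1) +
            (a.length : ℝ) * Real.log (FloatDenum.numDiv f a + 1) ^ 2) * Nat.totient f)) ∧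
      ∃ P : ℕ → Polynomial ℂ,
        (∀ i, (P i).degree < FloatDenum.numDiv f a) ∧
        FloatDenum.IsQuasiPoly f (FloatDenum.sylvesterWave f a) P ∧
        (FloatDenum.floatWave FloatDenum.Arith.exact f a).val =
          FloatDenum.coeffTable f (FloatDenum.numDiv f a) P ∧
        ∀ ε : ℝ, 0 < ε → ∃ u₀ : ℝ, 0 < u₀ ∧
          ∀ A : FloatDenum.Arith ℂ, A.HasRoundoff u₀ →
            List.Forall₂ (List.Forall₂ fun x y => ‖x - y‖ < ε)
              (FloatDenum.floatWave A f a).val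
              (FloatDenum.coeffTable f (FloatDenum.numDiv f a) P)) ∧
    (∀ M : ℕ, ∃ p : Polynomial ℕ, ∀ a : List ℕ,
      (∀ x ∈ a, 0 < x) → (a : Multiset ℕ).gcd = 1 → (∀ x ∈ a, x ≤ M) →
      ∀ A : FloatDenum.Arith ℂ, (FloatDenum.floatDenum A a).ops ≤ p.eval a.length) := by
  refine ⟨⟨8000, fun a f ha _ hfa => ?_⟩, fun M => ?_⟩
  · have hd := FloatDenum.numDiv_pos hfa
    have hf : 0 < f := by
      obtain ⟨x, hx, hfx⟩ := hfa
      exact Nat.pos_of_dvd_of_pos hfx (ha x hx)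
    refine ⟨fun A => FloatDenum.floatWave_ops_le_log A hf hd, FloatDenum.wavePoly f a,
      FloatDenum.degree_wavePoly_lt f a, FloatDenum.isQuasiPoly_sylvesterWave hf ha hd,
      FloatDenum.coeffTable_wavePoly hf hd, fun ε hε => ?_⟩
    rw [← FloatDenum.coeffTable_wavePoly hf hd]
    exact FloatDenum.exists_roundoff_floatWave hf ha hε
  · refine ⟨C M * ((2630 * (C M * (X * X)) + 604 * (X ^ 2 * X)) * C M), fun a ha _ hM A => ?_⟩
    simpa using FloatDenum.floatDenum_ops_le A ha hM
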